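/- **Setting.** Let $n\ge 0$ and $a=\xi_0<\xi_1<\dots<\xi_n<\xi_{n+1}=b$ be reals, $\Omega_k=(\xi_{k-1},\xi_k)$ for $k=1,\dots,n+1$, and $\Omega=\bigcup_k\Omega_k$. Let $\rho_1,\dots,\rho_{n+1}$ be reals with $\rho_k^2>0$, and put $\rho(x)=\rho_k^2$ on $\Omega_k$. Let $q$ be a real-valued function that is continuous on each $\Omega_k$ and has finite one-sided limits at the end points of each $\Omega_k$. Let $\delta_j,\gamma_j$ ($1\le j\le4$) and $\delta^{\pm}_{ij},\gamma^{\pm}_{ij}$ ($1\le i\le n$, $j=0,1$) be real numbers. For $1\le j<k\le4$ let $\theta_{ijk}$ be the determinant of the $j$-th and $k$-th columns of $$\begin{bmatrix}\delta^+_{i1}&\delta^+_{i0}&\delta^-_{i1}&\delta^-_{i0}\\ \gamma^+_{i1}&\gamma^+_{i0}&\gamma^-_{i1}&\gamma^-_{i0}\end{bmatrix}.$$ Assume $\theta_{ijk}>0$ for all $i$ and all $j<k$, and $$\kappa_1=\det\begin{bmatrix}\delta_3&\delta_4\\ \delta_1&\delta_2\end{bmatrix}>0,\qquad \kappa_2=\det\begin{bmatrix}\gamma_3&\gamma_4\\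 \gamma_1&\gamma_2\end{bmatrix}>0.$$ For a function $u$ on $\Omega$, the values of $u$ and $u'$ at $a$, $b$ and $\xi_i\mp$ mean the corresponding one-sided limits. Put $\ell u=-\rho u''+qu$ and $$B_a[u]=\delta_1u(a)-\delta_2u'(a),\quad B_a'[u]=\delta_3u(a)-\delta_4u'(a),\quad B_b[u]=\gamma_1u(b)-\gamma_2u'(b),\quad B_b'[u]=\gamma_3u(b)-\gamma_4u'(b).$$ The *transmission conditions* are, for $i=1,\dots,n$, $$\delta^-_{i1}u'(\xi_i-)+\delta^-_{i0}u(\xi_i-)+\delta^+_{i1}u'(\xi_i+)+\delta^+_{i0}u(\xi_i+)=0,$$ $$\gamma^-_{i1}u'(\xi_i-)+\gamma^-_{i0}u(\xi_i-)+\gamma^+_{i1}u'(\xi_i+)+\gamma^+_{i0}u(\xi_i+)=0.$$ **The boundary value transmission problem.** A number $\lambda\in\mathbb C$ is an eigenvalue of the problem if there is a function $u:\Omega\to\mathbb C$, not identically zero, twice differentiable on $\Omega$, such that $u$ and $u'$ have finite one-sided limits at the end points of each $\Omega_k$, $\ell u=\lambda u$ on $\Omega$, $B_a[u]-\lambda B'_a[u]=0$,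 $B_b[u]+\lambda B_b'[u]=0$, and $u$ satisfies the transmission conditions. **The operator.** Let $\mathcal H=L_2(a,\xi_1)\oplus\dots\oplus L_2(\xi_n,b)\oplus\mathbb C^2$ be the Hilbert space with the inner product $$\langle F,G\rangle=\sum_{k=0}^{n}\frac1{\rho_{k+1}^2}\prod_{i=1}^{k}\theta_{i12}\prod_{i=k+1}^{n}\theta_{i34}\int_{\xi_k}^{\xi_{k+1}}f\,\overline g\,dx+\prod_{i=1}^n\theta_{i34}\,\frac{f_1\overline{g_1}}{\kappa_1}+\prod_{i=1}^n\theta_{i12}\,\frac{f_2\overline{g_2}}{\kappa_2}$$ for $F=(f,f_1,f_2)$, $G=(g,g_1,g_2)$. The domain of the operator $\mathfrak R$ consists of all $(f,f_1,f_2)\in\mathcal H$ such that (for a suitable representative $f$) $f$ is differentiable on each $\Omega_k$; $f$ and $f'$ are locally absolutely continuous on each $\Omega_k$ and have finite one-sided limits at its end points; $\ell f\in L_2(\Omega_k)$ for each $k$; $f$ satisfies the transmission conditions; $f_1=B_a'[f]$ and $f_2=-B_b'[f]$. On it, $\mathfrak R(f,B'_a[f],-B'_b[f])=(\ell f,B_a[f],B_b[f])$.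 **Theorem.** The operator $\mathfrak R$ is densely defined and self-adjoint in $\mathcal H$, and $\lambda\in\mathbb C$ is an eigenvalue of $\mathfrak R$ if and only if it is an eigenvalue of the boundary value transmission problem. -/

import Mathlib

open MeasureTheory Set Filter Topology

/-- The vector space `E` with its inner product multiplied by the constant `c > 0`. -/
def Scaled (_c : {r : ℝ // 0 < r}) (E : Type*) : Type _ := E

namespace Scaled

noncomputable section

variable {c : {r : ℝ // 0 < r}} {E : Type*} [NormedAddCommGroup E] [InnerProductSpace ℂ E]

instance instAddCommGroup : AddCommGroup (Scaled c E) := inferInstanceAs (AddCommGroup E)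

instance instModule : Module ℂ (Scaled c E) := inferInstanceAs (Module ℂ E)

/-- The identity map `Scaled c E → E`. -/
def val : Scaled c E ≃ₗ[ℂ] E := LinearEquiv.refl ℂ E

/-- Multiplication by `√c`, which becomes an isometry of `Scaled c E` onto `E`. -/
def toBase : Scaled c E ≃ₗ[ℂ] E :=
  val.trans (LinearEquiv.smulOfNeZero ℂ E ((Real.sqrt c.1 : ℝ) : ℂ)
    (by exact_mod_cast (Real.sqrt_pos.2 c.2).ne'))

theorem toBase_apply (x : Scaled c E) : toBase x = ((Real.sqrt c.1 : ℝ) : ℂ) • val x := rfl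

instance instNormedAddCommGroup : NormedAddCommGroup (Scaled c E) :=
  NormedAddCommGroup.induced (Scaled c E) E (toBase (c := c) (E := E)).toLinearMap
    (toBase (c := c) (E := E)).injective

theorem norm_eq (x : Scaled c E) : ‖x‖ = ‖toBase x‖ := rfl

instance instInnerProductSpace : InnerProductSpace ℂ (Scaled c E) where
  norm_smul_le r x := by rw [norm_eq, norm_eq, map_smul, norm_smul]
  inner x y := ((c.1 : ℝ) : ℂ) * inner ℂ (val x) (val y)
  norm_sq_eq_re_inner x := by
    rw [norm_eq, toBase_apply, norm_smul, mul_pow, inner_self_eq_norm_sq_to_K]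
    have h : (((c.1 : ℝ) : ℂ) * ((‖val x‖ : ℝ) : ℂ) ^ 2) = ((c.1 * ‖val x‖ ^ 2 : ℝ) : ℂ) := by
      push_cast; rfl
    have h' := congrArg Complex.re h
    rw [Complex.ofReal_re] at h'
    refine Eq.trans ?_ h'.symm
    rw [Complex.norm_real, Real.norm_eq_abs, sq_abs, Real.sq_sqrt c.2.le]
  conj_inner_symm x y := by
    rw [map_mul, inner_conj_symm, Complex.conj_ofReal]
  add_left x y z := by rw [map_add, inner_add_left, mul_add]
  smul_left x y r := by rw [map_smul, inner_smul_left]; ring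

theorem inner_eq (x y : Scaled c E) :
    inner ℂ x y = ((c.1 : ℝ) : ℂ) * inner ℂ (val x) (val y) := rfl

instance instCompleteSpace [CompleteSpace E] : CompleteSpace (Scaled c E) := by
  let e : Scaled c E ≃ₗᵢ[ℂ] E := ⟨toBase, fun x => (norm_eq x).symm⟩
  exact (completeSpace_congr (e := e.toEquiv) e.isometry.isUniformEmbedding).2 inferInstance

end

end Scaled

/-- `f` is locally absolutely continuous on the open interval `(s, t)`: it is absolutely continuous
on every compact subinterval. -/
def LocallyAC (f : ℝ → ℂ) (s t : ℝ) : Prop :=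
  ∀ x y, s < x → x ≤ y → y < t → AbsolutelyContinuousOnInterval f x y

/-- `f` has finite limits `f(s+0)` and `f(t-0)`. -/
def HasEndLimits {Y : Type*} [TopologicalSpace Y] (f : ℝ → Y) (s t : ℝ) : Prop :=
  (∃ l, Tendsto f (𝓝[>] s) (𝓝 l)) ∧ (∃ l, Tendsto f (𝓝[<] t) (𝓝 l))

theorem LocallyAC.ae_differentiableAt {f : ℝ → ℂ} {s t : ℝ} (hf : LocallyAC f s t) :
    ∀ᵐ x ∂(volume.restrict (Ioo s t)), DifferentiableAt ℝ f x := by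
  have hbv : LocallyBoundedVariationOn f (Ioo s t) := by
    intro x y hx hy
    rcases le_total x y with h | h
    · refine (hf x y hx.1 h hy.2).boundedVariationOn.mono ?_
      rw [uIcc_of_le h]; exact inter_subset_right
    · refine (hf y x hy.1 h hx.2).boundedVariationOn.mono ?_
      rw [uIcc_of_le h]
      rintro z ⟨-, h1, h2⟩
      exact ⟨h.trans h1, h2.trans h⟩
  rw [ae_restrict_iff' measurableSet_Ioo]
  filter_upwards [hbv.ae_differentiableWithinAt_of_mem] with x hx hxs
  exact (hx hxs).differentiableAt (isOpen_Ioo.mem_nhds hxs)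

theorem LocallyAC.congr {f g : ℝ → ℂ} {s t : ℝ} (hf : LocallyAC f s t)
    (h : EqOn g f (Ioo s t)) : LocallyAC g s t := by
  intro x y hx hxy hy
  have hs : uIcc x y ⊆ Ioo s t := by
    rw [uIcc_of_le hxy]; exact fun z hz => ⟨hx.trans_le hz.1, hz.2.trans_lt hy⟩
  have h1 := hf x y hx hxy hy
  rw [absolutelyContinuousOnInterval_iff] at h1 ⊢
  intro ε hε
  obtain ⟨d, hd, H⟩ := h1 ε hε
  refine ⟨d, hd, fun E hE hl => ?_⟩
  refine lt_of_eq_of_lt (Finset.sum_congr rfl fun i hi => ?_) (H E hE hl)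
  rw [h (hs (hE.1 i hi).1), h (hs (hE.1 i hi).2)]

theorem HasEndLimits.comb {f g h : ℝ → ℂ} {s t : ℝ} {c : ℂ} (hf : HasEndLimits f s t)
    (hst : s < t) (hg : HasEndLimits g s t) (H : EqOn h (fun x => f x + c * g x) (Ioo s t)) :
    HasEndLimits h s t ∧
      Function.rightLim h s = Function.rightLim f s + c * Function.rightLim g s ∧
      Function.leftLim h t = Function.leftLim f t + c * Function.leftLim g t := by
  obtain ⟨⟨l, hl⟩, m, hm⟩ := hf
  obtain ⟨⟨l', hl'⟩, m', hm'⟩ := hg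
  have h1 : Tendsto h (𝓝[>] s) (𝓝 (l + c * l')) := by
    refine (hl.add (hl'.const_mul c)).congr' ?_
    filter_upwards [Ioo_mem_nhdsGT hst] with x hx using (H hx).symm
  have h2 : Tendsto h (𝓝[<] t) (𝓝 (m + c * m')) := by
    refine (hm.add (hm'.const_mul c)).congr' ?_
    filter_upwards [Ioo_mem_nhdsLT hst] with x hx using (H hx).symm
  refine ⟨⟨⟨_, h1⟩, _, h2⟩, ?_, ?_⟩
  · rw [rightLim_eq_of_tendsto h1, rightLim_eq_of_tendsto hl, rightLim_eq_of_tendsto hl']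
  · rw [leftLim_eq_of_tendsto h2, leftLim_eq_of_tendsto hm, leftLim_eq_of_tendsto hm']

/-- The data of a boundary value transmission problem with `n` interior points, and the standing
assumptions on them.

The points are `a = ξ 0 < ξ 1 < ⋯ < ξ n < ξ (n + 1) = b`. The pieces `(ξ k, ξ (k + 1))` are indexed
by `k : Fin (n + 1)`; the interior point with index `i : Fin n` is `ξ (i + 1)`. The suffixes `p`
and `m` stand for the coefficients of the right (`+`) and left (`-`) limits. -/
structure TransmissionProblem (n : ℕ) where
  ξ : Fin (n + 2) → ℝ
  ξ_strictMono : StrictMono ξ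
  ρ : Fin (n + 1) → ℝ
  ρ_sq_pos : ∀ k, 0 < ρ k ^ 2
  q : ℝ → ℝ
  q_continuousOn : ∀ k : Fin (n + 1), ContinuousOn q (Ioo (ξ k.castSucc) (ξ k.succ))
  q_limits : ∀ k : Fin (n + 1), HasEndLimits q (ξ k.castSucc) (ξ k.succ)
  (δ₁ δ₂ δ₃ δ₄ : ℝ)
  (γ₁ γ₂ γ₃ γ₄ : ℝ)
  (δp0 δp1 δm0 δm1 : Fin n → ℝ)
  (γp0 γp1 γm0 γm1 : Fin n → ℝ)
  /-- All `2 × 2` minors of the transmission matrices are positive. -/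
  minor_pos : ∀ (i : Fin n) (j k : Fin 4), j < k →
    0 < ((!![δp1 i, δp0 i, δm1 i, δm0 i; γp1 i, γp0 i, γm1 i, γm0 i] :
      Matrix (Fin 2) (Fin 4) ℝ).submatrix id ![j, k]).det
  κ₁_pos : 0 < (!![δ₃, δ₄; δ₁, δ₂] : Matrix (Fin 2) (Fin 2) ℝ).det
  κ₂_pos : 0 < (!![γ₃, γ₄; γ₁, γ₂] : Matrix (Fin 2) (Fin 2) ℝ).det

namespace TransmissionProblem

noncomputable section

variable {n : ℕ} (P : TransmissionProblem n)

/-- The left end point. -/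
def a : ℝ := P.ξ 0

/-- The right end point. -/
def b : ℝ := P.ξ (Fin.last (n + 1))

/-- The `k`-th piece of `Ω`. -/
def piece (k : Fin (n + 1)) : Set ℝ := Ioo (P.ξ k.castSucc) (P.ξ k.succ)

/-- The `i`-th interior point. -/
def pt (i : Fin n) : ℝ := P.ξ i.castSucc.succ

/-- The coefficient matrix of the transmission conditions at the `i`-th interior point. -/
def transMatrix (i : Fin n) : Matrix (Fin 2) (Fin 4) ℝ :=
  !![P.δp1 i, P.δp0 i, P.δm1 i, P.δm0 i; P.γp1 i, P.γp0 i, P.γm1 i, P.γm0 i]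

/-- The minor of columns `j` and `k` (counted from `0`) of the transmission matrix. -/
def θ (i : Fin n) (j k : Fin 4) : ℝ := ((P.transMatrix i).submatrix id ![j, k]).det

def κ₁ : ℝ := (!![P.δ₃, P.δ₄; P.δ₁, P.δ₂] : Matrix (Fin 2) (Fin 2) ℝ).det

def κ₂ : ℝ := (!![P.γ₃, P.γ₄; P.γ₁, P.γ₂] : Matrix (Fin 2) (Fin 2) ℝ).det

theorem θ_pos (i : Fin n) {j k : Fin 4} (h : j < k) : 0 < P.θ i j k := P.minor_pos i j k h

/-! ### The differential expression and the boundary and transmission functionals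

A function on `Ω` is a function `u : ℝ → ℂ` of which only the restriction to the pieces matters;
its values at the points `ξ i` are one-sided limits. -/

/-- `-ρ u'' + q u` on the `k`-th piece, where `ρ = ρ_k²`. -/
def ell (k : Fin (n + 1)) (u : ℝ → ℂ) (x : ℝ) : ℂ :=
  -((P.ρ k : ℂ) ^ 2) * deriv (deriv u) x + (P.q x : ℂ) * u x

def Ba (u : ℝ → ℂ) : ℂ :=
  P.δ₁ * Function.rightLim u P.a - P.δ₂ * Function.rightLim (deriv u) P.a

def Ba' (u : ℝ → ℂ) : ℂ :=
  P.δ₃ * Function.rightLim u P.a - P.δ₄ * Function.rightLim (deriv u) P.a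

def Bb (u : ℝ → ℂ) : ℂ :=
  P.γ₁ * Function.leftLim u P.b - P.γ₂ * Function.leftLim (deriv u) P.b

def Bb' (u : ℝ → ℂ) : ℂ :=
  P.γ₃ * Function.leftLim u P.b - P.γ₄ * Function.leftLim (deriv u) P.b

/-- The first transmission functional at the `i`-th interior point. -/
def transδ (i : Fin n) (u : ℝ → ℂ) : ℂ :=
  P.δm1 i * Function.leftLim (deriv u) (P.pt i) + P.δm0 i * Function.leftLim u (P.pt i)
    + P.δp1 i * Function.rightLim (deriv u) (P.pt i) + P.δp0 i * Function.rightLim u (P.pt i)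

/-- The second transmission functional at the `i`-th interior point. -/
def transγ (i : Fin n) (u : ℝ → ℂ) : ℂ :=
  P.γm1 i * Function.leftLim (deriv u) (P.pt i) + P.γm0 i * Function.leftLim u (P.pt i)
    + P.γp1 i * Function.rightLim (deriv u) (P.pt i) + P.γp0 i * Function.rightLim u (P.pt i)

/-! ### The boundary value transmission problem -/

/-- `u` solves the problem with spectral parameter `lam`. -/
structure IsSolution (lam : ℂ) (u : ℝ → ℂ) : Prop where
  diff : ∀ k, DifferentiableOn ℝ u (P.piece k)
  diff' : ∀ k, DifferentiableOn ℝ (deriv u) (P.piece k)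
  lim : ∀ k : Fin (n + 1), HasEndLimits u (P.ξ k.castSucc) (P.ξ k.succ)
  lim' : ∀ k : Fin (n + 1), HasEndLimits (deriv u) (P.ξ k.castSucc) (P.ξ k.succ)
  eqn : ∀ k, ∀ x ∈ P.piece k, P.ell k u x = lam * u x
  left : P.Ba u - lam * P.Ba' u = 0
  right : P.Bb u + lam * P.Bb' u = 0
  trans₁ : ∀ i, P.transδ i u = 0
  trans₂ : ∀ i, P.transγ i u = 0

/-- `lam` is an eigenvalue of the boundary value transmission problem: there is a solution that does
not vanish identically on `Ω`. -/
def IsEigenvalue (lam : ℂ) : Prop :=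
  ∃ u, P.IsSolution lam u ∧ ∃ k, ∃ x ∈ P.piece k, u x ≠ 0

/-! ### The Hilbert space -/

/-- `∏_{i ≤ k} θ_{i12} ∏_{i > k} θ_{i34}`, the products being over the interior points, which are
numbered from `1` in this formula. -/
def thetaProd (k : Fin (n + 1)) : ℝ :=
  (∏ i : Fin n with i.val < k.val, P.θ i 0 1) * ∏ i : Fin n with k.val ≤ i.val, P.θ i 2 3

theorem thetaProd_pos (k : Fin (n + 1)) : 0 < P.thetaProd k :=
  mul_pos (Finset.prod_pos fun i _ => P.θ_pos i (by decide))
    (Finset.prod_pos fun i _ => P.θ_pos i (by decide))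

/-- The weight of the `k`-th piece in the inner product. -/
def weight (k : Fin (n + 1)) : {r : ℝ // 0 < r} :=
  ⟨1 / P.ρ k ^ 2 * P.thetaProd k,
    mul_pos (one_div_pos.2 (P.ρ_sq_pos k)) (P.thetaProd_pos k)⟩

/-- The weight of the component attached to `a`. -/
def weightA : {r : ℝ // 0 < r} :=
  ⟨(∏ i, P.θ i 2 3) / P.κ₁,
    div_pos (Finset.prod_pos fun i _ => P.θ_pos i (by decide)) P.κ₁_pos⟩

/-- The weight of the component attached to `b`. -/
def weightB : {r : ℝ // 0 < r} :=
  ⟨(∏ i, P.θ i 0 1) / P.κ₂,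
    div_pos (Finset.prod_pos fun i _ => P.θ_pos i (by decide)) P.κ₂_pos⟩

/-- Lebesgue measure on the `k`-th piece. -/
abbrev pieceMeasure (k : Fin (n + 1)) : Measure ℝ := volume.restrict (P.piece k)

/-- The direct sum of the spaces `L²(ξ k, ξ (k + 1))` with the weighted inner product. -/
abbrev H₁ : Type := PiLp 2 fun k => Scaled (P.weight k) (Lp ℂ 2 (P.pieceMeasure k))

/-- The Hilbert space `H₁ ⊕ ℂ²` with the weighted inner product. -/
abbrev H : Type := WithLp 2 (P.H₁ × WithLp 2 (Scaled P.weightA ℂ × Scaled P.weightB ℂ))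

variable {P} in
/-- The function component of `F` on the `k`-th piece. -/
def fn (F : P.H) (k : Fin (n + 1)) : Lp ℂ 2 (P.pieceMeasure k) := Scaled.val (F.fst k)

variable {P} in
/-- The component of `F` attached to `a`. -/
def cA (F : P.H) : ℂ := Scaled.val F.snd.fst

variable {P} in
/-- The component of `F` attached to `b`. -/
def cB (F : P.H) : ℂ := Scaled.val F.snd.snd

/-- The element of `H` with given components. -/
def mkH (f : ∀ k, Lp ℂ 2 (P.pieceMeasure k)) (z w : ℂ) : P.H :=
  WithLp.toLp 2 (WithLp.toLp 2 fun k => Scaled.val.symm (f k),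
    WithLp.toLp 2 (Scaled.val.symm z, Scaled.val.symm w))

variable {P} in
/-- The inner product of `H` (conjugate linear in the first argument). -/
theorem inner_eq (F G : P.H) :
    inner ℂ G F =
      (∑ k, ((1 / P.ρ k ^ 2 * P.thetaProd k : ℝ) : ℂ) *
        ∫ x in P.piece k, fn F k x * (starRingEnd ℂ) (fn G k x))
      + (((∏ i, P.θ i 2 3) / P.κ₁ : ℝ) : ℂ) * (cA F * (starRingEnd ℂ) (cA G))
      + (((∏ i, P.θ i 0 1) / P.κ₂ : ℝ) : ℂ) * (cB F * (starRingEnd ℂ) (cB G)) := by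
  rw [WithLp.prod_inner_apply, WithLp.prod_inner_apply, PiLp.inner_apply, ← add_assoc]
  rfl

variable {P} in
theorem H_ext {F G : P.H} (h : ∀ k, fn F k = fn G k) (hA : cA F = cA G) (hB : cB F = cB G) :
    F = G := by
  have h1 : F.fst = G.fst := PiLp.ext fun k => Scaled.val.injective (h k)
  have h2 : F.snd.fst = G.snd.fst := Scaled.val.injective hA
  have h3 : F.snd.snd = G.snd.snd := Scaled.val.injective hB
  have h4 : F.snd = G.snd := by
    apply (WithLp.equiv 2 _).injective
    exact Prod.ext h2 h3
  apply (WithLp.equiv 2 _).injective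
  exact Prod.ext h1 h4

/-! ### The operator -/

/-- `u` is a function on `Ω` representing the element `F` of the domain of the operator. -/
structure Represents (u : ℝ → ℂ) (F : P.H) : Prop where
  diff : ∀ k, DifferentiableOn ℝ u (P.piece k)
  ac : ∀ k : Fin (n + 1), LocallyAC u (P.ξ k.castSucc) (P.ξ k.succ)
  ac' : ∀ k : Fin (n + 1), LocallyAC (deriv u) (P.ξ k.castSucc) (P.ξ k.succ)
  lim : ∀ k : Fin (n + 1), HasEndLimits u (P.ξ k.castSucc) (P.ξ k.succ)
  lim' : ∀ k : Fin (n + 1), HasEndLimits (deriv u) (P.ξ k.castSucc) (P.ξ k.succ)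
  ell_memLp : ∀ k, MemLp (P.ell k u) 2 (P.pieceMeasure k)
  trans₁ : ∀ i, P.transδ i u = 0
  trans₂ : ∀ i, P.transγ i u = 0
  fn_eq : ∀ k, fn F k =ᵐ[P.pieceMeasure k] u
  cA_eq : cA F = P.Ba' u
  cB_eq : cB F = -P.Bb' u

variable {P}

/-- The image `(ℓ u, B_a[u], B_b[u])` of the element represented by `u`. -/
def Represents.image {u : ℝ → ℂ} {F : P.H} (h : P.Represents u F) : P.H :=
  P.mkH (fun k => (h.ell_memLp k).toLp (P.ell k u)) (P.Ba u) (P.Bb u)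

theorem isOpen_piece (k : Fin (n + 1)) : IsOpen (P.piece k) := isOpen_Ioo

theorem ξ_lt (k : Fin (n + 1)) : P.ξ k.castSucc < P.ξ k.succ :=
  P.ξ_strictMono (Fin.castSucc_lt_succ)

/-- On every piece, `w = u + c v`. -/
def IsComb (P : TransmissionProblem n) (c : ℂ) (u v w : ℝ → ℂ) : Prop :=
  ∀ k, EqOn w (fun x => u x + c * v x) (P.piece k)

section Linearity

variable {c : ℂ} {u v w : ℝ → ℂ} {F G : P.H}

theorem fn_comb (k : Fin (n + 1)) : fn (F + c • G) k = fn F k + c • fn G k := rfl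

theorem cA_comb : cA (F + c • G) = cA F + c * cA G := rfl

theorem cB_comb : cB (F + c • G) = cB F + c * cB G := rfl

theorem IsComb.deriv (h : P.IsComb c u v w) (hu : P.Represents u F) (hv : P.Represents v G) :
    P.IsComb c (deriv u) (deriv v) (deriv w) := by
  intro k x hx
  have hn := (isOpen_piece (P := P) k).mem_nhds hx
  have he : w =ᶠ[𝓝 x] fun x => u x + c * v x := by
    filter_upwards [hn] with y hy using h k hy
  have h1 := ((hu.diff k).differentiableAt hn).hasDerivAt
  have h2 := ((hv.diff k).differentiableAt hn).hasDerivAt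
  rw [he.deriv_eq]
  exact (h1.add (h2.const_mul c)).deriv

theorem IsComb.ell_ae (h : P.IsComb c u v w) (hu : P.Represents u F) (hv : P.Represents v G)
    (k : Fin (n + 1)) :
    P.ell k w =ᵐ[P.pieceMeasure k] fun x => P.ell k u x + c * P.ell k v x := by
  filter_upwards [(hu.ac' k).ae_differentiableAt, (hv.ac' k).ae_differentiableAt,
    ae_restrict_mem measurableSet_Ioo] with x h1 h2 hx
  have hn := (isOpen_piece (P := P) k).mem_nhds hx
  have he : _root_.deriv w =ᶠ[𝓝 x] fun x => _root_.deriv u x + c * _root_.deriv v x := by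
    filter_upwards [hn] with y hy using h.deriv hu hv k hy
  have h3 : _root_.deriv (_root_.deriv w) x =
      _root_.deriv (_root_.deriv u) x + c * _root_.deriv (_root_.deriv v) x := by
    rw [he.deriv_eq]
    exact (h1.hasDerivAt.add (h2.hasDerivAt.const_mul c)).deriv
  have h4 : w x = u x + c * v x := h k hx
  simp only [ell, h3, h4]
  ring

theorem IsComb.lims (h : P.IsComb c u v w) (hu : P.Represents u F) (hv : P.Represents v G)
    (k : Fin (n + 1)) :
    (HasEndLimits w (P.ξ k.castSucc) (P.ξ k.succ) ∧
      Function.rightLim w (P.ξ k.castSucc) =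
        Function.rightLim u (P.ξ k.castSucc) + c * Function.rightLim v (P.ξ k.castSucc) ∧
      Function.leftLim w (P.ξ k.succ) =
        Function.leftLim u (P.ξ k.succ) + c * Function.leftLim v (P.ξ k.succ)) ∧
    (HasEndLimits (_root_.deriv w) (P.ξ k.castSucc) (P.ξ k.succ) ∧
      Function.rightLim (_root_.deriv w) (P.ξ k.castSucc) =
        Function.rightLim (_root_.deriv u) (P.ξ k.castSucc)
          + c * Function.rightLim (_root_.deriv v) (P.ξ k.castSucc) ∧
      Function.leftLim (_root_.deriv w) (P.ξ k.succ) =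
        Function.leftLim (_root_.deriv u) (P.ξ k.succ)
          + c * Function.leftLim (_root_.deriv v) (P.ξ k.succ)) :=
  ⟨(hu.lim k).comb (ξ_lt k) (hv.lim k) (h k),
    (hu.lim' k).comb (ξ_lt k) (hv.lim' k) (h.deriv hu hv k)⟩

theorem IsComb.functionals (h : P.IsComb c u v w) (hu : P.Represents u F)
    (hv : P.Represents v G) :
    (P.Ba w = P.Ba u + c * P.Ba v ∧ P.Ba' w = P.Ba' u + c * P.Ba' v ∧
      P.Bb w = P.Bb u + c * P.Bb v ∧ P.Bb' w = P.Bb' u + c * P.Bb' v) ∧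
    (∀ i, P.transδ i w = P.transδ i u + c * P.transδ i v) ∧
    ∀ i, P.transγ i w = P.transγ i u + c * P.transγ i v := by
  have ha := (h.lims hu hv 0).1.2.1
  have ha' := (h.lims hu hv 0).2.2.1
  have hb := (h.lims hu hv (Fin.last n)).1.2.2
  have hb' := (h.lims hu hv (Fin.last n)).2.2.2
  rw [Fin.succ_last] at hb hb'
  rw [Fin.castSucc_zero] at ha ha'
  have hl i := (h.lims hu hv (Fin.castSucc i)).1.2.2
  have hl' i := (h.lims hu hv (Fin.castSucc i)).2.2.2
  have hr i := (h.lims hu hv (Fin.succ i)).1.2.1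
  have hr' i := (h.lims hu hv (Fin.succ i)).2.2.1
  simp only [← Fin.succ_castSucc] at hr hr'
  refine ⟨⟨?_, ?_, ?_, ?_⟩, fun i => ?_, fun i => ?_⟩
  · simp only [Ba, a, ha, ha']; ring
  · simp only [Ba', a, ha, ha']; ring
  · simp only [Bb, b, hb, hb']; ring
  · simp only [Bb', b, hb, hb']; ring
  · simp only [transδ, pt, hl, hl', hr, hr']; ring
  · simp only [transγ, pt, hl, hl', hr, hr']; ring

theorem Represents.comb (hu : P.Represents u F) (hv : P.Represents v G) (c : ℂ) :
    P.Represents (fun x => u x + c * v x) (F + c • G) := by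
  have h : P.IsComb c u v (fun x => u x + c * v x) := fun k x _ => rfl
  obtain ⟨⟨-, hA, -, hB⟩, ht1, ht2⟩ := h.functionals hu hv
  refine ⟨fun k => (hu.diff k).add ((hv.diff k).const_mul c), ?_, ?_, fun k => (h.lims hu hv k).1.1,
    fun k => (h.lims hu hv k).2.1, ?_, ?_, ?_, ?_, ?_, ?_⟩
  · intro k x y hx hxy hy
    exact (hu.ac k x y hx hxy hy).add ((hv.ac k x y hx hxy hy).const_smul c)
  · intro k
    refine LocallyAC.congr (f := fun x => _root_.deriv u x + c * _root_.deriv v x) ?_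
      (h.deriv hu hv k)
    intro x y hx hxy hy
    exact (hu.ac' k x y hx hxy hy).add ((hv.ac' k x y hx hxy hy).const_smul c)
  · intro k
    exact ((hu.ell_memLp k).add ((hv.ell_memLp k).const_mul c)).ae_eq (h.ell_ae hu hv k).symm
  · intro i; rw [ht1, hu.trans₁, hv.trans₁]; simp
  · intro i; rw [ht2, hu.trans₂, hv.trans₂]; simp
  · intro k
    rw [fn_comb]
    filter_upwards [Lp.coeFn_add (fn F k) (c • fn G k), Lp.coeFn_smul c (fn G k), hu.fn_eq k,
      hv.fn_eq k] with x h1 h2 h3 h4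
    rw [h1, Pi.add_apply, h2, Pi.smul_apply, h3, h4, smul_eq_mul]
  · rw [cA_comb, hA, hu.cA_eq, hv.cA_eq]
  · rw [cB_comb, hB, hu.cB_eq, hv.cB_eq]; ring

theorem Represents.eqOn (hu : P.Represents u F) (hv : P.Represents v F) (k : Fin (n + 1)) :
    EqOn u v (P.piece k) :=
  Measure.eqOn_open_of_ae_eq ((hu.fn_eq k).symm.trans (hv.fn_eq k)) (isOpen_piece k)
    (hu.diff k).continuousOn (hv.diff k).continuousOn

theorem Represents.image_comb (hu : P.Represents u F) (hv : P.Represents v G)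
    {K : P.H} (hw : P.Represents w K) (hK : K = F + c • G) :
    hw.image = hu.image + c • hv.image := by
  subst hK
  have h : P.IsComb c u v w := fun k => hw.eqOn (hu.comb hv c) k
  obtain ⟨⟨hA, -, hB, -⟩, -, -⟩ := h.functionals hu hv
  refine H_ext (fun k => ?_) hA hB
  rw [fn_comb]
  change (hw.ell_memLp k).toLp _ = (hu.ell_memLp k).toLp _ + c • (hv.ell_memLp k).toLp _
  rw [← MemLp.toLp_const_smul, ← MemLp.toLp_add]
  exact MemLp.toLp_congr _ _ (h.ell_ae hu hv k)

theorem represents_zero (P : TransmissionProblem n) : P.Represents (fun _ => 0) 0 := by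
  have hd : _root_.deriv (fun _ : ℝ => (0 : ℂ)) = fun _ => 0 := by funext x; simp
  have hl : ∀ x : ℝ, Function.leftLim (fun _ : ℝ => (0 : ℂ)) x = 0 := fun x =>
    leftLim_eq_of_tendsto tendsto_const_nhds
  have hr : ∀ x : ℝ, Function.rightLim (fun _ : ℝ => (0 : ℂ)) x = 0 := fun x =>
    rightLim_eq_of_tendsto tendsto_const_nhds
  have hac : ∀ s t, LocallyAC (fun _ : ℝ => (0 : ℂ)) s t := fun s t x y _ _ _ => by
    rw [absolutelyContinuousOnInterval_iff]
    exact fun ε hε => ⟨1, one_pos, fun E _ _ => by simpa using hε⟩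
  have hlim : ∀ s t, HasEndLimits (fun _ : ℝ => (0 : ℂ)) s t := fun s t =>
    ⟨⟨0, tendsto_const_nhds⟩, 0, tendsto_const_nhds⟩
  refine ⟨fun k => differentiableOn_const _, fun k => hac _ _, fun k => by rw [hd]; exact hac _ _,
    fun k => hlim _ _, fun k => by rw [hd]; exact hlim _ _, fun k => ?_, fun i => ?_, fun i => ?_,
    fun k => Lp.coeFn_zero _ _ _, ?_, ?_⟩
  · have : P.ell k (fun _ => 0) = fun _ => 0 := by funext x; simp [ell, hd]
    rw [this]
    exact MemLp.zero
  · simp [transδ, hd, hl, hr]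
  · simp [transγ, hd, hl, hr]
  · change (0 : ℂ) = _
    simp [Ba', hd, hr]
  · change (0 : ℂ) = _
    simp [Bb', hd, hl]

end Linearity

/-- The domain of the operator. -/
def dom (P : TransmissionProblem n) : Submodule ℂ P.H where
  carrier := {F | ∃ u, P.Represents u F}
  zero_mem' := ⟨_, represents_zero P⟩
  add_mem' := by
    rintro F G ⟨u, hu⟩ ⟨v, hv⟩
    exact ⟨_, by simpa only [one_smul] using hu.comb hv 1⟩
  smul_mem' := by
    rintro c F ⟨u, hu⟩
    exact ⟨_, by simpa only [zero_add] using (represents_zero P).comb hu c⟩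

theorem Represents.image_eq {F : P.H} {u v : ℝ → ℂ} (hu : P.Represents u F)
    (hv : P.Represents v F) : hu.image = hv.image := by
  have h := Represents.image_comb (c := 0) hv hv hu (by rw [zero_smul, add_zero])
  rwa [zero_smul, add_zero] at h

/-- The operator, `(u, B_a'[u], -B_b'[u]) ↦ (ℓ u, B_a[u], B_b[u])`. -/
def R (P : TransmissionProblem n) : P.H →ₗ.[ℂ] P.H where
  domain := P.dom
  toFun :=
    { toFun := fun F => (Classical.choose_spec F.2 : P.Represents _ F.1).image
      map_add' := by
        intro F G
        have hF : P.Represents _ F.1 := Classical.choose_spec F.2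
        have hG : P.Represents _ G.1 := Classical.choose_spec G.2
        have hS : P.Represents _ (F + G).1 := Classical.choose_spec (F + G).2
        have h := Represents.image_comb (c := 1) hF hG hS (by rw [one_smul]; rfl)
        rwa [one_smul] at h
      map_smul' := by
        intro c F
        have hF : P.Represents _ F.1 := Classical.choose_spec F.2
        have hS : P.Represents _ (c • F).1 := Classical.choose_spec (c • F).2
        have h := Represents.image_comb (c := c - 1) hF hF hS
          (by rw [sub_smul, one_smul, add_sub_cancel]; rfl)
        rw [sub_smul, one_smul, add_sub_cancel] at h
        exact h }

/-- The action of the operator does not depend on the representing function. -/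
theorem R_apply {u : ℝ → ℂ} (F : P.R.domain) (hu : P.Represents u (F : P.H)) :
    P.R F = hu.image :=
  Represents.image_eq (Classical.choose_spec F.2) hu

end

end TransmissionProblem

open scoped ComplexConjugate

/-! ### Absolutely continuous complex functions and primitives -/

/-! Symmetry. On each piece the functions of the domain are twofold primitives of `L²` functions, so
integration by parts is available (`IsTwicePrim.green`). The factors `1 / ρ²` of the weights cancel
the leading coefficient of `ℓ`, the real term `q` drops out, and only the brackets `u' v̄ - u v̄'`
at the ends of the pieces remain. At an interior point the transmission conditions equate, up to
sign, the images of the Cauchy data from the two sides under matrices with determinants `θ_{i34}`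
and `θ_{i12}`; the products of minors in the weights are what makes the two brackets cancel
(`jump_eq_zero`). At `a` and `b` the bracket times `κ` is, up to sign, the determinant formed from
`B` and `B'`, and the two scalar components cancel it (`bracket_a`, `bracket_b`).

Maximality. Suppose `⟨G, R F⟩ = ⟨K, F⟩` for all `F` in the domain. Test functions living on one
piece, with zero Cauchy data at both ends, show that `ℓ g` is weakly the function part of `K`. Hence
`g` differs from a twofold primitive by an affine function (`exists_isTwicePrim_of_weak`). Green's
formula then removes all integrals and leaves a form in finitely many boundary values of the test
function (`boundary_form_eq_zero`). These can be prescribed freely by cubics, and since the minors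
and `κ₁`, `κ₂` are nonzero, suitable choices yield each remaining condition. So `G` is in the domain
with image `K` (`exists_represents_of_adjoint`). Density follows as well: if `K` is orthogonal to
the domain, then the pair `(0, K)` satisfies the hypothesis, so `K = R 0 = 0`.

Eigenvalues. An eigenvector solves the equation almost everywhere. As `q` is continuous on the
pieces, `u''` agrees almost everywhere with a continuous function and the solution is classical.
Conversely, a classical solution has a continuous, square integrable second derivative and lies in
the domain. -/

theorem AbsolutelyContinuousOnInterval.of_dist_le {X Y : Type*} [PseudoMetricSpace X]
    [PseudoMetricSpace Y] {f : ℝ → X} {g : ℝ → Y} {a b : ℝ}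
    (hg : AbsolutelyContinuousOnInterval g a b)
    (h : ∀ x ∈ uIcc a b, ∀ y ∈ uIcc a b, dist (f x) (f y) ≤ dist (g x) (g y)) :
    AbsolutelyContinuousOnInterval f a b := by
  rw [absolutelyContinuousOnInterval_iff] at hg ⊢
  intro ε hε
  obtain ⟨d, hd, H⟩ := hg ε hε
  refine ⟨d, hd, fun E hE hl => ?_⟩
  exact lt_of_le_of_lt (Finset.sum_le_sum fun i hi => h _ (hE.1 i hi).1 _ (hE.1 i hi).2)
    (H E hE hl)

theorem AbsolutelyContinuousOnInterval.conj {f : ℝ → ℂ} {a b : ℝ}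
    (hf : AbsolutelyContinuousOnInterval f a b) :
    AbsolutelyContinuousOnInterval (fun x => conj (f x)) a b :=
  hf.of_dist_le fun x _ y _ => (Complex.dist_conj_conj (f x) (f y)).le

theorem MeasureTheory.LocallyIntegrable.intervalIntegrable' {φ : ℝ → ℂ}
    (hφ : LocallyIntegrable φ volume) (x y : ℝ) : IntervalIntegrable φ volume x y :=
  ((hφ.integrableOn_isCompact isCompact_uIcc).intervalIntegrable)

noncomputable section

/-- The primitive of `φ` with the value `α` at `s`. -/
def prim (s : ℝ) (α : ℂ) (φ : ℝ → ℂ) (x : ℝ) : ℂ := α + ∫ y in s..x, φ y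

variable {s t : ℝ} {α β : ℂ} {φ : ℝ → ℂ}

theorem prim_self : prim s α φ s = α := by simp [prim]

theorem prim_sub (hφ : LocallyIntegrable φ volume) (x y : ℝ) :
    prim s α φ y - prim s α φ x = ∫ z in x..y, φ z := by
  have h := intervalIntegral.integral_add_adjacent_intervals (hφ.intervalIntegrable' s x)
    (hφ.intervalIntegrable' x y)
  simp only [prim]
  rw [← h]; ring

/-- Increments of the primitive of `φ` are dominated by those of the primitive of `‖φ‖`, which
reduces the claim to a real integrand. -/
theorem prim_ac (hφ : LocallyIntegrable φ volume) (x y : ℝ) :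
    AbsolutelyContinuousOnInterval (prim s α φ) x y := by
  have h1 : IntervalIntegrable (fun z => ‖φ z‖) volume x y := (hφ.intervalIntegrable' x y).norm
  refine (h1.absolutelyContinuousOnInterval_intervalIntegral left_mem_uIcc).of_dist_le ?_
  intro z _ w _
  rw [dist_comm, dist_comm (∫ v in x..z, ‖φ v‖), dist_eq_norm, dist_eq_norm, prim_sub hφ,
    intervalIntegral.integral_interval_sub_left (hφ.intervalIntegrable' _ _).norm
      (hφ.intervalIntegrable' _ _).norm]
  exact intervalIntegral.norm_integral_le_abs_integral_norm

theorem prim_continuous (hφ : LocallyIntegrable φ volume) : Continuous (prim s α φ) :=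
  continuous_const.add (intervalIntegral.continuous_primitive hφ.intervalIntegrable' s)

theorem prim_locallyIntegrable (hφ : LocallyIntegrable φ volume) :
    LocallyIntegrable (prim s α φ) volume :=
  (prim_continuous hφ).locallyIntegrable

theorem prim_hasDerivAt (hφ : Continuous φ) (x : ℝ) : HasDerivAt (prim s α φ) (φ x) x :=
  (hφ.integral_hasStrictDerivAt s x).hasDerivAt.const_add α

theorem prim_ae_hasDerivAt (hφ : LocallyIntegrable φ volume) :
    ∀ᵐ x, HasDerivAt (prim s α φ) (φ x) x := by
  filter_upwards [_root_.LocallyIntegrable.ae_hasDerivAt_integral hφ] with x hx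
  exact (hx s).const_add α

theorem prim_eq_of_hasDerivAt {f : ℝ → ℂ} (h : ∀ x, HasDerivAt f (φ x) x) (hφ : Continuous φ) :
    prim s (f s) φ = f := by
  funext x
  rw [prim, intervalIntegral.integral_eq_sub_of_hasDerivAt (fun y _ => h y)
    (hφ.intervalIntegrable _ _)]
  ring

/-- Fundamental theorem of calculus for absolutely continuous functions. -/
theorem AbsolutelyContinuousOnInterval.sub_eq {f : ℝ → ℂ} {x y : ℝ} (hxy : x ≤ y)
    (hf : AbsolutelyContinuousOnInterval f x y) (hφ : LocallyIntegrable φ volume)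
    (h : ∀ᵐ z ∂(volume.restrict (Ioo x y)), HasDerivAt f (φ z) z) :
    f y - f x = ∫ z in x..y, φ z := by
  -- Subtracting the primitive of `φ` leaves an absolutely continuous function with derivative zero
  -- almost everywhere, hence a constant. The end points are discarded as a null set.
  have h0 : ∀ᵐ z, z ∈ uIcc x y → HasDerivAt (f - prim x 0 φ) 0 z := by
    rw [ae_restrict_iff' measurableSet_Ioo] at h
    filter_upwards [h, prim_ae_hasDerivAt (s := x) (α := 0) hφ, Measure.ae_ne volume x,
      Measure.ae_ne volume y] with z h1 h2 hx hy hz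
    rw [uIcc_of_le hxy] at hz
    have h3 := (h1 ⟨lt_of_le_of_ne hz.1 hx.symm, lt_of_le_of_ne hz.2 hy⟩).sub h2
    rwa [sub_self] at h3
  obtain ⟨C, hC⟩ := (hf.sub (prim_ac hφ x y)).const_of_ae_hasDerivAt_zero h0
  have h1 := hC x left_mem_uIcc
  have h2 := hC y right_mem_uIcc
  rw [← prim_sub (s := x) (α := 0) hφ]
  simp only [Pi.sub_apply] at h1 h2
  linear_combination h2 - h1

/-- The increment formula is known strictly inside the interval only; the initial value `l` enters
by letting the left point tend to `s`. -/
theorem eqOn_prim_of_sub_eq {f : ℝ → ℂ} {l : ℂ} (hφ : LocallyIntegrable φ volume)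
    (hl : Tendsto f (𝓝[>] s) (𝓝 l))
    (h : ∀ x y, s < x → x ≤ y → y < t → f y - f x = ∫ z in x..y, φ z) :
    EqOn f (prim s l φ) (Ioo s t) := by
  intro y hy
  have h1 : Tendsto (fun x => f x + (prim s l φ y - prim s l φ x)) (𝓝[>] s)
      (𝓝 (l + (prim s l φ y - l))) := by
    refine hl.add (tendsto_const_nhds.sub ?_)
    have := (prim_continuous (s := s) (α := l) hφ).tendsto s
    rw [prim_self] at this
    exact this.mono_left nhdsWithin_le_nhds
  have h2 : Tendsto (fun x => f x + (prim s l φ y - prim s l φ x)) (𝓝[>] s) (𝓝 (f y)) := by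
    refine tendsto_const_nhds.congr' ?_
    filter_upwards [Ioo_mem_nhdsGT hy.1] with x hx
    rw [prim_sub hφ, ← h x y hx.1 hx.2.le hy.2]; ring
  rw [tendsto_nhds_unique h2 h1]; ring

/-- On `(s, t)`, the function `u` has the second derivative `φ ∈ L²`, and `u(s+) = α`,
`u'(s+) = β`. -/
structure IsTwicePrim (s t : ℝ) (α β : ℂ) (φ u : ℝ → ℂ) : Prop where
  locInt : LocallyIntegrable φ volume
  memLp : MemLp φ 2 (volume.restrict (Ioo s t))
  eqOn : EqOn u (prim s α (prim s β φ)) (Ioo s t)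

/-- The one-sided limits extend `f` continuously to the compact interval `[s, t]`, where it is
bounded. -/
theorem memLp_top_of_continuousOn {f : ℝ → ℂ} (hf : ContinuousOn f (Ioo s t))
    (hl : HasEndLimits f s t) : MemLp f ⊤ (volume.restrict (Ioo s t)) := by
  obtain ⟨⟨l, hl⟩, m, hm⟩ := hl
  obtain ⟨C, hC⟩ := isCompact_Icc.exists_bound_of_continuousOn
    (continuousOn_Icc_extendFrom_Ioo hf hl hm)
  refine memLp_top_of_bound (hf.aestronglyMeasurable measurableSet_Ioo) C ?_
  filter_upwards [ae_restrict_mem measurableSet_Ioo] with x hx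
  have := hC x (Ioo_subset_Icc_self hx)
  rwa [extendFrom_extends hf x hx] at this

theorem memLp_of_continuous {f : ℝ → ℂ} (hf : Continuous f) (p : ENNReal) :
    MemLp f p (volume.restrict (Ioo s t)) :=
  (memLp_top_of_continuousOn hf.continuousOn
    ⟨⟨_, (hf.tendsto s).mono_left nhdsWithin_le_nhds⟩, _,
      (hf.tendsto t).mono_left nhdsWithin_le_nhds⟩).mono_exponent le_top

/-! ### Calculus of twofold primitives on one interval. -/

namespace IsTwicePrim

variable {u : ℝ → ℂ}

theorem deriv_eqOn (h : IsTwicePrim s t α β φ u) : EqOn (deriv u) (prim s β φ) (Ioo s t) := by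
  intro x hx
  have he : u =ᶠ[𝓝 x] prim s α (prim s β φ) := by
    filter_upwards [isOpen_Ioo.mem_nhds hx] with y hy using h.eqOn hy
  rw [he.deriv_eq]
  exact (prim_hasDerivAt (prim_continuous h.locInt) x).deriv

theorem differentiableOn (h : IsTwicePrim s t α β φ u) : DifferentiableOn ℝ u (Ioo s t) :=
  DifferentiableOn.congr (fun x _ =>
    (prim_hasDerivAt (prim_continuous h.locInt) x).differentiableAt.differentiableWithinAt) h.eqOn

theorem locallyAC (h : IsTwicePrim s t α β φ u) : LocallyAC u s t :=
  LocallyAC.congr (fun x y _ _ _ => prim_ac (prim_locallyIntegrable h.locInt) x y) h.eqOn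

theorem locallyAC_deriv (h : IsTwicePrim s t α β φ u) : LocallyAC (deriv u) s t :=
  LocallyAC.congr (fun x y _ _ _ => prim_ac h.locInt x y) h.deriv_eqOn

theorem deriv_deriv_ae (h : IsTwicePrim s t α β φ u) :
    deriv (deriv u) =ᵐ[volume.restrict (Ioo s t)] φ := by
  filter_upwards [ae_restrict_mem measurableSet_Ioo,
    ae_restrict_of_ae (prim_ae_hasDerivAt (s := s) (α := β) h.locInt)] with x hx hd
  have he : deriv u =ᶠ[𝓝 x] prim s β φ := by
    filter_upwards [isOpen_Ioo.mem_nhds hx] with y hy using h.deriv_eqOn hy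
  rw [he.deriv_eq, hd.deriv]

theorem tendsto_of_eqOn {f g : ℝ → ℂ} (hst : s < t) (hg : Continuous g) (h : EqOn f g (Ioo s t)) :
    Tendsto f (𝓝[>] s) (𝓝 (g s)) ∧ Tendsto f (𝓝[<] t) (𝓝 (g t)) := by
  constructor
  · refine ((hg.tendsto s).mono_left nhdsWithin_le_nhds).congr' ?_
    filter_upwards [Ioo_mem_nhdsGT hst] with x hx using (h hx).symm
  · refine ((hg.tendsto t).mono_left nhdsWithin_le_nhds).congr' ?_
    filter_upwards [Ioo_mem_nhdsLT hst] with x hx using (h hx).symm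

theorem tendsto (h : IsTwicePrim s t α β φ u) (hst : s < t) :
    Tendsto u (𝓝[>] s) (𝓝 α) ∧ Tendsto u (𝓝[<] t) (𝓝 (prim s α (prim s β φ) t)) := by
  simpa only [prim_self] using
    tendsto_of_eqOn hst (prim_continuous (prim_locallyIntegrable h.locInt)) h.eqOn

theorem tendsto_deriv (h : IsTwicePrim s t α β φ u) (hst : s < t) :
    Tendsto (deriv u) (𝓝[>] s) (𝓝 β) ∧ Tendsto (deriv u) (𝓝[<] t) (𝓝 (prim s β φ t)) := by
  simpa only [prim_self] using tendsto_of_eqOn hst (prim_continuous h.locInt) h.deriv_eqOn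

theorem hasEndLimits (h : IsTwicePrim s t α β φ u) (hst : s < t) : HasEndLimits u s t :=
  ⟨⟨_, (h.tendsto hst).1⟩, _, (h.tendsto hst).2⟩

theorem hasEndLimits_deriv (h : IsTwicePrim s t α β φ u) (hst : s < t) :
    HasEndLimits (deriv u) s t :=
  ⟨⟨_, (h.tendsto_deriv hst).1⟩, _, (h.tendsto_deriv hst).2⟩

theorem rightLim_eq (h : IsTwicePrim s t α β φ u) (hst : s < t) : Function.rightLim u s = α :=
  rightLim_eq_of_tendsto (h.tendsto hst).1

theorem rightLim_deriv (h : IsTwicePrim s t α β φ u) (hst : s < t) :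
    Function.rightLim (deriv u) s = β :=
  rightLim_eq_of_tendsto (h.tendsto_deriv hst).1

theorem leftLim_eq (h : IsTwicePrim s t α β φ u) (hst : s < t) :
    Function.leftLim u t = prim s α (prim s β φ) t :=
  leftLim_eq_of_tendsto (h.tendsto hst).2

theorem leftLim_deriv (h : IsTwicePrim s t α β φ u) (hst : s < t) :
    Function.leftLim (deriv u) t = prim s β φ t :=
  leftLim_eq_of_tendsto (h.tendsto_deriv hst).2

theorem memLp_top (h : IsTwicePrim s t α β φ u) (hst : s < t) :
    MemLp u ⊤ (volume.restrict (Ioo s t)) :=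
  memLp_top_of_continuousOn h.differentiableOn.continuousOn (h.hasEndLimits hst)

theorem memLp_two (h : IsTwicePrim s t α β φ u) (hst : s < t) :
    MemLp u 2 (volume.restrict (Ioo s t)) :=
  (h.memLp_top hst).mono_exponent le_top

theorem congr {v : ℝ → ℂ} (h : IsTwicePrim s t α β φ u) (hv : EqOn v u (Ioo s t)) :
    IsTwicePrim s t α β φ v :=
  ⟨h.locInt, h.memLp, hv.trans h.eqOn⟩

theorem zero : IsTwicePrim s t 0 0 (fun _ => 0) (fun _ => 0) :=
  ⟨continuous_const.locallyIntegrable, MemLp.zero, fun x _ => by simp [prim]⟩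

/-- The second derivative is cut off outside `(s, t)` to be integrable on the whole line. Absolute
continuity recovers `u'` from `u''`; for `u` the classical fundamental theorem suffices, since `u'`
exists everywhere and equals a continuous function. -/
theorem of_locallyAC (hd : DifferentiableOn ℝ u (Ioo s t))
    (hac : LocallyAC (deriv u) s t) (hl : HasEndLimits u s t) (hl' : HasEndLimits (deriv u) s t)
    (hm : MemLp (deriv (deriv u)) 2 (volume.restrict (Ioo s t))) :
    IsTwicePrim s t (Function.rightLim u s) (Function.rightLim (deriv u) s)
      ((Ioo s t).indicator (deriv (deriv u))) u := by
  have hi : LocallyIntegrable ((Ioo s t).indicator (deriv (deriv u))) volume :=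
    (IntegrableOn.integrable_indicator (hm.integrable one_le_two)
      measurableSet_Ioo).locallyIntegrable
  have h1 : EqOn (deriv u) (prim s (Function.rightLim (deriv u) s)
      ((Ioo s t).indicator (deriv (deriv u)))) (Ioo s t) := by
    refine eqOn_prim_of_sub_eq hi (tendsto_rightLim_of_tendsto hl'.1) ?_
    intro x y hx hxy hy
    have hsub : Ioo x y ⊆ Ioo s t := Ioo_subset_Ioo hx.le hy.le
    refine (hac x y hx hxy hy).sub_eq hxy hi ?_
    filter_upwards [ae_mono (Measure.restrict_mono_set _ hsub) hac.ae_differentiableAt,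
      ae_restrict_mem measurableSet_Ioo] with z hz hz'
    rw [indicator_of_mem (hsub hz')]
    exact hz.hasDerivAt
  refine ⟨hi, ?_, ?_⟩
  · refine hm.ae_eq ?_
    filter_upwards [ae_restrict_mem measurableSet_Ioo] with z hz
    rw [indicator_of_mem hz]
  · have hc := prim_continuous (s := s) (α := Function.rightLim (deriv u) s) hi
    refine eqOn_prim_of_sub_eq (prim_locallyIntegrable hi) (tendsto_rightLim_of_tendsto hl.1) ?_
    intro x y hx hxy hy
    rw [intervalIntegral.integral_eq_sub_of_hasDerivAt _ (hc.intervalIntegrable _ _)]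
    intro z hz
    rw [uIcc_of_le hxy] at hz
    have hz' : z ∈ Ioo s t := ⟨hx.trans_le hz.1, hz.2.trans_lt hy⟩
    rw [← h1 hz']
    exact (hd.differentiableAt (isOpen_Ioo.mem_nhds hz')).hasDerivAt

/-- Green's formula on an interval. -/
theorem green {γ δ : ℂ} {ψ v : ℝ → ℂ} (hst : s < t) (hu : IsTwicePrim s t α β φ u)
    (hv : IsTwicePrim s t γ δ ψ v) :
    (∫ x in Ioo s t, φ x * conj (v x)) - ∫ x in Ioo s t, u x * conj (ψ x) =
      (Function.leftLim (deriv u) t * conj (Function.leftLim v t)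
        - Function.leftLim u t * conj (Function.leftLim (deriv v) t))
      - (Function.rightLim (deriv u) s * conj (Function.rightLim v s)
        - Function.rightLim u s * conj (Function.rightLim (deriv v) s)) := by
  rw [hu.leftLim_eq hst, hu.leftLim_deriv hst, hu.rightLim_eq hst, hu.rightLim_deriv hst,
    hv.leftLim_eq hst, hv.leftLim_deriv hst, hv.rightLim_eq hst, hv.rightLim_deriv hst]
  set U1 := prim s β φ with hU1
  set U := prim s α U1 with hU
  set V1 := prim s δ ψ with hV1
  set V := prim s γ V1 with hV
  have cU1 : Continuous U1 := prim_continuous hu.locInt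
  have cV1 : Continuous V1 := prim_continuous hv.locInt
  have cU : Continuous U := prim_continuous cU1.locallyIntegrable
  have cV : Continuous V := prim_continuous cV1.locallyIntegrable
  have i1 : Integrable (fun x => φ x * conj (v x)) (volume.restrict (Ioo s t)) :=
    hu.memLp.integrable_mul (hv.memLp_two hst).star
  have i2 : Integrable (fun x => u x * conj (ψ x)) (volume.restrict (Ioo s t)) :=
    (hu.memLp_two hst).integrable_mul hv.memLp.star
  rw [← integral_sub i1 i2]
  -- The bracket is formed from the global primitives, which are absolutely continuous up to the end
  -- points, whereas `u` and `v` may have arbitrary values there. In its derivative the products of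
  -- first derivatives cancel.
  have hac : AbsolutelyContinuousOnInterval
      (fun x => U1 x * conj (V x) - U x * conj (V1 x)) s t := by
    have a1 : AbsolutelyContinuousOnInterval U1 s t := prim_ac hu.locInt s t
    have a2 : AbsolutelyContinuousOnInterval V1 s t := prim_ac hv.locInt s t
    have a3 : AbsolutelyContinuousOnInterval U s t := prim_ac cU1.locallyIntegrable s t
    have a4 : AbsolutelyContinuousOnInterval V s t := prim_ac cV1.locallyIntegrable s t
    exact (a1.smul a4.conj).sub (a3.smul a2.conj)
  have hloc : LocallyIntegrable ((Ioo s t).indicator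
      fun x => φ x * conj (v x) - u x * conj (ψ x)) volume :=
    (IntegrableOn.integrable_indicator (i1.sub i2) measurableSet_Ioo).locallyIntegrable
  have hmain := hac.sub_eq hst.le hloc ?_
  · rw [intervalIntegral.integral_of_le hst.le, integral_Ioc_eq_integral_Ioo,
      setIntegral_indicator measurableSet_Ioo, inter_self] at hmain
    rw [← hmain]
    simp only [hU1, hU, hV1, hV, prim_self]
  · filter_upwards [ae_restrict_mem measurableSet_Ioo,
      ae_restrict_of_ae (prim_ae_hasDerivAt (s := s) (α := β) hu.locInt),
      ae_restrict_of_ae (prim_ae_hasDerivAt (s := s) (α := δ) hv.locInt)] with x hx d1 d2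
    have d3 : HasDerivAt U (U1 x) x := prim_hasDerivAt cU1 x
    have d4 : HasDerivAt V (V1 x) x := prim_hasDerivAt cV1 x
    rw [indicator_of_mem hx, hu.eqOn hx, hv.eqOn hx]
    refine ((d1.mul d4.star).sub (d3.mul d2.star)).congr_deriv ?_
    change φ x * conj (V x) + U1 x * conj (V1 x) - (U1 x * conj (V1 x) + U x * conj (ψ x)) =
      φ x * conj (V x) - U x * conj (ψ x)
    ring

/-- Functions with prescribed boundary values. -/
theorem exists_boundary (hst : s < t) (α β α' β' : ℂ) :
    ∃ φ u, IsTwicePrim s t α β φ u ∧ prim s α (prim s β φ) t = α' ∧ prim s β φ t = β' := by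
  -- A cubic suffices: its second derivative is `A + B (x - s)`, and the data at `t` give two linear
  -- equations for `A` and `B` with determinant `-(t - s)^4 / 12`.
  obtain ⟨A, B, hA, hB⟩ : ∃ A B : ℂ, β + A * (t - s) + B / 2 * (t - s) ^ 2 = β' ∧
      α + β * (t - s) + A / 2 * (t - s) ^ 2 + B / 6 * (t - s) ^ 3 = α' := by
    have h : (t - s : ℂ) ≠ 0 := by
      rw [← Complex.ofReal_sub]; exact_mod_cast (sub_pos.2 hst).ne'
    refine ⟨(6 * (α' - α - β * (t - s)) / (t - s) - 2 * (β' - β)) / (t - s),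
      (6 * (β' - β) - 12 * (α' - α - β * (t - s)) / (t - s)) / (t - s) ^ 2, ?_, ?_⟩ <;>
    · field_simp; ring
  have hd (x : ℝ) : HasDerivAt (fun x : ℝ => (x - s : ℂ)) 1 x :=
    (Complex.ofRealCLM.hasDerivAt).sub_const _
  have c0 : Continuous fun x : ℝ => A + B * (x - s) := by fun_prop
  have h1 : prim s β (fun x : ℝ => A + B * (x - s)) =
      fun x : ℝ => β + A * (x - s) + B / 2 * (x - s) ^ 2 := by
    have := prim_eq_of_hasDerivAt (s := s)
      (f := fun x : ℝ => β + A * (x - s) + B / 2 * (x - s) ^ 2) (φ := fun x => A + B * (x - s))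
      (fun x => by
        refine ((((hd x).const_mul A).const_add β).add
          (((hd x).pow 2).const_mul (B / 2))).congr_deriv ?_
        push_cast; ring) c0
    simpa using this
  have h2 : prim s α (fun x : ℝ => β + A * (x - s) + B / 2 * (x - s) ^ 2) =
      fun x : ℝ => α + β * (x - s) + A / 2 * (x - s) ^ 2 + B / 6 * (x - s) ^ 3 := by
    have := prim_eq_of_hasDerivAt (s := s)
      (f := fun x : ℝ => α + β * (x - s) + A / 2 * (x - s) ^ 2 + B / 6 * (x - s) ^ 3)
      (φ := fun x => β + A * (x - s) + B / 2 * (x - s) ^ 2)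
      (fun x => by
        refine (((((hd x).const_mul β).const_add α).add
          (((hd x).pow 2).const_mul (A / 2))).add
          (((hd x).pow 3).const_mul (B / 6))).congr_deriv ?_
        push_cast; ring) (by fun_prop)
    simpa using this
  refine ⟨fun x : ℝ => A + B * (x - s), _, ⟨c0.locallyIntegrable, ?_, fun x _ => rfl⟩, ?_, ?_⟩
  · exact memLp_of_continuous c0 2
  · rw [h1, h2]; exact hB
  · rw [h1]; exact hA

end IsTwicePrim

/-! ### Weak second derivatives in `L²`. -/

/-- A function in `L²` that is orthogonal to the orthogonal complement of the affine functions is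
affine. -/
theorem ae_eq_affine_of_orthogonal (f : Lp ℂ 2 (volume.restrict (Ioo s t)))
    (h : ∀ φ : Lp ℂ 2 (volume.restrict (Ioo s t)), (∫ x in Ioo s t, φ x) = 0 →
      (∫ x in Ioo s t, φ x * (x : ℂ)) = 0 → ∫ x in Ioo s t, φ x * conj (f x) = 0) :
    ∃ a b : ℂ, f =ᵐ[volume.restrict (Ioo s t)] fun x => a + b * x := by
  have m1 : MemLp (fun _ : ℝ => (1 : ℂ)) 2 (volume.restrict (Ioo s t)) :=
    memLp_of_continuous continuous_const 2
  have m2 : MemLp (fun x : ℝ => (x : ℂ)) 2 (volume.restrict (Ioo s t)) :=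
    memLp_of_continuous Complex.continuous_ofReal 2
  -- The span of `1` and `x` is finite dimensional, so it equals its double orthogonal complement.
  have hf : f ∈ (Submodule.span ℂ {m1.toLp, m2.toLp})ᗮᗮ := by
    rw [Submodule.mem_orthogonal]
    intro φ hφ
    rw [Submodule.mem_orthogonal] at hφ
    have h1 := hφ _ (Submodule.subset_span (mem_insert _ _))
    have h2 := hφ _ (Submodule.subset_span (mem_insert_of_mem _ rfl))
    rw [← inner_conj_symm, L2.inner_def]
    have h3 := h φ ?_ ?_
    · simpa [RCLike.inner_apply] using congrArg conj h3
    · rw [L2.inner_def] at h1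
      rw [← h1]
      refine integral_congr_ae ?_
      filter_upwards [m1.coeFn_toLp] with x hx
      rw [hx]; simp
    · rw [L2.inner_def] at h2
      rw [← h2]
      refine integral_congr_ae ?_
      filter_upwards [m2.coeFn_toLp] with x hx
      rw [hx]; simp
  have : FiniteDimensional ℂ (Submodule.span ℂ {m1.toLp, m2.toLp}) :=
    FiniteDimensional.span_of_finite ℂ (toFinite _)
  rw [Submodule.orthogonal_orthogonal, Submodule.mem_span_pair] at hf
  obtain ⟨a, b, rfl⟩ := hf
  refine ⟨a, b, ?_⟩
  filter_upwards [Lp.coeFn_add (a • m1.toLp) (b • m2.toLp), Lp.coeFn_smul a m1.toLp,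
    Lp.coeFn_smul b m2.toLp, m1.coeFn_toLp, m2.coeFn_toLp] with x h1 h2 h3 h4 h5
  rw [h1, Pi.add_apply, h2, h3, Pi.smul_apply, Pi.smul_apply, h4, h5]
  simp

/-- If `g'' = r` weakly in `L²`, then `g` is a twofold primitive of `r`. -/
theorem exists_isTwicePrim_of_weak (hst : s < t) {g r : ℝ → ℂ}
    (hg : MemLp g 2 (volume.restrict (Ioo s t))) (hr : MemLp r 2 (volume.restrict (Ioo s t)))
    (h : ∀ φ u, IsTwicePrim s t 0 0 φ u → prim s 0 (prim s 0 φ) t = 0 → prim s 0 φ t = 0 →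
      ∫ x in Ioo s t, φ x * conj (g x) = ∫ x in Ioo s t, u x * conj (r x)) :
    ∃ α β φ v, IsTwicePrim s t α β φ v ∧ φ =ᵐ[volume.restrict (Ioo s t)] r ∧
      g =ᵐ[volume.restrict (Ioo s t)] v := by
  have key : ∀ {f : ℝ → ℂ}, MemLp f 2 (volume.restrict (Ioo s t)) →
      (Ioo s t).indicator f =ᵐ[volume.restrict (Ioo s t)] f ∧
      IsTwicePrim s t 0 0 ((Ioo s t).indicator f)
        (prim s 0 (prim s 0 ((Ioo s t).indicator f))) := by
    intro f hf
    have he : (Ioo s t).indicator f =ᵐ[volume.restrict (Ioo s t)] f :=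
      indicator_ae_eq_restrict measurableSet_Ioo
    exact ⟨he, (IntegrableOn.integrable_indicator (hf.integrable one_le_two)
      measurableSet_Ioo).locallyIntegrable, hf.ae_eq he.symm, fun x _ => rfl⟩
  obtain ⟨hre, hv⟩ := key hr
  set v := prim s 0 (prim s 0 ((Ioo s t).indicator r)) with hvdef
  have hf : MemLp (g - v) 2 (volume.restrict (Ioo s t)) := hg.sub (hv.memLp_two hst)
  -- Orthogonality of `φ` to `1` and `x` says exactly that its twofold primitive with zero data at
  -- `s` also has zero data at `t`, so it is an admissible test function. For it, the hypothesis on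
  -- `g` and Green's formula for `v` have the same right-hand side.
  have horth : ∀ φ : Lp ℂ 2 (volume.restrict (Ioo s t)), (∫ x in Ioo s t, φ x) = 0 →
      (∫ x in Ioo s t, φ x * (x : ℂ)) = 0 →
      ∫ x in Ioo s t, φ x * conj (hf.toLp (g - v) x) = 0 := by
    intro φ h1 h2
    obtain ⟨hφe, hu⟩ := key (Lp.memLp φ)
    have e1 : prim s 0 ((Ioo s t).indicator φ) t = 0 := by
      rw [prim, intervalIntegral.integral_of_le hst.le, integral_Ioc_eq_integral_Ioo,
        setIntegral_indicator measurableSet_Ioo, inter_self, h1, zero_add]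
    have hx : IsTwicePrim s t s 1 (fun _ => 0) (fun x : ℝ => (x : ℂ)) := by
      refine ⟨continuous_const.locallyIntegrable, MemLp.zero, fun x _ => ?_⟩
      simp [prim]
    -- Green's formula against the function `x` gives `∫ φ x = t u'(t) - u(t)`, where `u'(t) = 0`
    -- already.
    have e2 : prim s 0 (prim s 0 ((Ioo s t).indicator φ)) t = 0 := by
      have := hu.green hst hx
      rw [hu.leftLim_eq hst, hu.leftLim_deriv hst, hu.rightLim_eq hst, hu.rightLim_deriv hst,
        hx.leftLim_deriv hst, e1] at this
      have h3 : ∫ x in Ioo s t, (Ioo s t).indicator φ x * conj (x : ℂ) = 0 := by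
        rw [← h2]
        refine integral_congr_ae ?_
        filter_upwards [hφe] with x hx
        rw [hx, Complex.conj_ofReal]
      rw [h3] at this
      simpa [prim] using this
    have h3 := h _ _ hu e2 e1
    have h4 := hu.green hst hv
    rw [hu.leftLim_eq hst, hu.leftLim_deriv hst, hu.rightLim_eq hst, hu.rightLim_deriv hst,
      e1, e2] at h4
    simp only [zero_mul, sub_zero] at h4
    have h5 : ∫ x in Ioo s t, prim s 0 (prim s 0 ((Ioo s t).indicator φ)) x *
        conj ((Ioo s t).indicator r x) =
        ∫ x in Ioo s t, prim s 0 (prim s 0 ((Ioo s t).indicator φ)) x * conj (r x) := by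
      refine integral_congr_ae ?_
      filter_upwards [hre] with x hx
      rw [hx]
    rw [h5, ← h3, ← integral_sub] at h4
    · rw [← neg_eq_zero, ← integral_neg, ← h4]
      refine integral_congr_ae ?_
      filter_upwards [hφe, hf.coeFn_toLp] with x h6 h7
      rw [h6, h7, Pi.sub_apply, map_sub]
      ring
    · exact hu.memLp.integrable_mul (hv.memLp_two hst).star
    · exact hu.memLp.integrable_mul hg.star
  obtain ⟨a, b, hab⟩ := ae_eq_affine_of_orthogonal (hf.toLp (g - v)) horth
  -- The affine difference is absorbed into the initial data: value `a + b s` and slope `b` at `s`.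
  refine ⟨a + b * s, b, (Ioo s t).indicator r, _, ⟨hv.locInt, hv.memLp, fun x _ => rfl⟩, hre, ?_⟩
  have hd (x : ℝ) : HasDerivAt (fun x : ℝ => v x + (a + b * x))
      (prim s b ((Ioo s t).indicator r) x) x := by
    refine ((prim_hasDerivAt (prim_continuous hv.locInt) x).add
      ((Complex.ofRealCLM.hasDerivAt.const_mul b).const_add a)).congr_deriv ?_
    simp [prim, add_comm]
  have h1 := prim_eq_of_hasDerivAt (s := s) hd (prim_continuous hv.locInt)
  have h2 : v s = 0 := by rw [hvdef, prim_self]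
  rw [h2, zero_add] at h1
  rw [h1]
  filter_upwards [hab, hf.coeFn_toLp] with x h3 h4
  rw [← h3, h4]
  simp

end

namespace TransmissionProblem

noncomputable section

/-! ### Functions with square integrable second derivatives on the pieces -/

variable {n : ℕ} {P : TransmissionProblem n}

/-- On every piece, `u` has the second derivative `φ k ∈ L²`, and `u` and `u'` have one-sided limits
at the end points. -/
def Regular (P : TransmissionProblem n) (u : ℝ → ℂ) (φ : Fin (n + 1) → ℝ → ℂ) : Prop :=
  ∀ k : Fin (n + 1), ∃ α β, IsTwicePrim (P.ξ k.castSucc) (P.ξ k.succ) α β (φ k) u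

theorem q_continuousOn_complex (k : Fin (n + 1)) :
    ContinuousOn (fun x => (P.q x : ℂ)) (P.piece k) :=
  Complex.continuous_ofReal.comp_continuousOn (P.q_continuousOn k)

theorem q_memLp_top (k : Fin (n + 1)) : MemLp (fun x => (P.q x : ℂ)) ⊤ (P.pieceMeasure k) := by
  obtain ⟨⟨l, hl⟩, m, hm⟩ := P.q_limits k
  exact memLp_top_of_continuousOn (q_continuousOn_complex k)
    ⟨⟨_, (Complex.continuous_ofReal.tendsto l).comp hl⟩, _,
      (Complex.continuous_ofReal.tendsto m).comp hm⟩

theorem memLp_q_mul {k : Fin (n + 1)} {f : ℝ → ℂ} (hf : MemLp f 2 (P.pieceMeasure k)) :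
    MemLp (fun x => (P.q x : ℂ) * f x) 2 (P.pieceMeasure k) :=
  hf.mul (q_memLp_top k)

theorem ρ_ne_zero (k : Fin (n + 1)) : (P.ρ k : ℂ) ≠ 0 := by
  have h := (P.ρ_sq_pos k).ne'
  exact_mod_cast fun h0 => h (by rw [h0]; norm_num)

/-- Solving for `u''` gives `ρ² u'' = q u - ℓ u`, and `q` and `u` are bounded on the piece. -/
theorem Represents.regular {u : ℝ → ℂ} {F : P.H} (h : P.Represents u F) :
    P.Regular u fun k => (P.piece k).indicator (deriv (deriv u)) := by
  intro k
  refine ⟨_, _, IsTwicePrim.of_locallyAC (h.diff k) (h.ac' k) (h.lim k) (h.lim' k) ?_⟩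
  have h1 : MemLp u 2 (P.pieceMeasure k) :=
    (memLp_top_of_continuousOn (h.diff k).continuousOn (h.lim k)).mono_exponent le_top
  have h2 := ((memLp_q_mul h1).sub (h.ell_memLp k)).const_mul (((P.ρ k : ℂ) ^ 2)⁻¹)
  refine h2.ae_eq (Eventually.of_forall fun x => ?_)
  have := ρ_ne_zero (P := P) k
  simp only [Pi.sub_apply, ell]
  field_simp
  ring

namespace Regular

variable {u v : ℝ → ℂ} {φ ψ : Fin (n + 1) → ℝ → ℂ}

theorem memLp_two (hu : P.Regular u φ) (k : Fin (n + 1)) : MemLp u 2 (P.pieceMeasure k) := by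
  obtain ⟨α, β, h⟩ := hu k
  exact h.memLp_two (ξ_lt k)

theorem ell_ae (hu : P.Regular u φ) (k : Fin (n + 1)) :
    P.ell k u =ᵐ[P.pieceMeasure k] fun x => -((P.ρ k : ℂ) ^ 2) * φ k x + P.q x * u x := by
  obtain ⟨α, β, h⟩ := hu k
  filter_upwards [h.deriv_deriv_ae] with x hx
  rw [ell, hx]

theorem memLp_second (hu : P.Regular u φ) (k : Fin (n + 1)) :
    MemLp (φ k) 2 (P.pieceMeasure k) := by
  obtain ⟨α, β, h⟩ := hu k
  exact h.memLp

theorem memLp_ell (hu : P.Regular u φ) (k : Fin (n + 1)) :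
    MemLp (P.ell k u) 2 (P.pieceMeasure k) :=
  (((hu.memLp_second k).const_mul _).add (memLp_q_mul (hu.memLp_two k))).ae_eq (hu.ell_ae k).symm

theorem represents (hu : P.Regular u φ) (h1 : ∀ i, P.transδ i u = 0)
    (h2 : ∀ i, P.transγ i u = 0) {F : P.H} (hF : ∀ k, fn F k =ᵐ[P.pieceMeasure k] u)
    (hA : cA F = P.Ba' u) (hB : cB F = -P.Bb' u) : P.Represents u F := by
  choose α β h using hu
  exact ⟨fun k => (h k).differentiableOn, fun k => (h k).locallyAC, fun k => (h k).locallyAC_deriv,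
    fun k => (h k).hasEndLimits (ξ_lt k), fun k => (h k).hasEndLimits_deriv (ξ_lt k),
    memLp_ell fun k => ⟨_, _, h k⟩, h1, h2, hF, hA, hB⟩

theorem exists_represents (hu : P.Regular u φ) (h1 : ∀ i, P.transδ i u = 0)
    (h2 : ∀ i, P.transγ i u = 0) : ∃ F, P.Represents u F :=
  ⟨P.mkH (fun k => (hu.memLp_two k).toLp u) (P.Ba' u) (-P.Bb' u),
    hu.represents h1 h2 (fun k => (hu.memLp_two k).coeFn_toLp) rfl rfl⟩

end Regular

/-! ### Green's formula -/

/-- `u' v̄ - u v̄'` at `x - 0`. -/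
def bracketL (u v : ℝ → ℂ) (x : ℝ) : ℂ :=
  Function.leftLim (deriv u) x * conj (Function.leftLim v x)
    - Function.leftLim u x * conj (Function.leftLim (deriv v) x)

/-- `u' v̄ - u v̄'` at `x + 0`. -/
def bracketR (u v : ℝ → ℂ) (x : ℝ) : ℂ :=
  Function.rightLim (deriv u) x * conj (Function.rightLim v x)
    - Function.rightLim u x * conj (Function.rightLim (deriv v) x)

section Green

variable {u v : ℝ → ℂ} {φ ψ : Fin (n + 1) → ℝ → ℂ}

/-- The contributions of `q` to the two integrals agree because `q` is real, and the weight `1 / ρ²`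
cancels the coefficient of `u''`. -/
theorem green_piece (hu : P.Regular u φ) (hv : P.Regular v ψ) (k : Fin (n + 1)) :
    ((1 / P.ρ k ^ 2 * P.thetaProd k : ℝ) : ℂ) * (∫ x in P.piece k, P.ell k u x * conj (v x))
      - ((1 / P.ρ k ^ 2 * P.thetaProd k : ℝ) : ℂ) * (∫ x in P.piece k, u x * conj (P.ell k v x))
      = P.thetaProd k * bracketR u v (P.ξ k.castSucc)
        - P.thetaProd k * bracketL u v (P.ξ k.succ) := by
  obtain ⟨α, β, h⟩ := hu k
  obtain ⟨γ, δ, h'⟩ := hv k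
  have hg := h.green (ξ_lt k) h'
  have i1 : Integrable (fun x => φ k x * conj (v x)) (P.pieceMeasure k) :=
    (hu.memLp_second k).integrable_mul (hv.memLp_two k).star
  have i2 : Integrable (fun x => u x * conj (ψ k x)) (P.pieceMeasure k) :=
    (hu.memLp_two k).integrable_mul (hv.memLp_second k).star
  have i3 : Integrable (fun x => P.q x * u x * conj (v x)) (P.pieceMeasure k) :=
    (memLp_q_mul (hu.memLp_two k)).integrable_mul (hv.memLp_two k).star
  have e1 : ∫ x in P.piece k, P.ell k u x * conj (v x) =
      -((P.ρ k : ℂ) ^ 2) * (∫ x in P.piece k, φ k x * conj (v x))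
        + ∫ x in P.piece k, P.q x * u x * conj (v x) := by
    rw [← integral_const_mul, ← integral_add (i1.const_mul _) i3]
    refine integral_congr_ae ?_
    filter_upwards [hu.ell_ae k] with x hx
    rw [hx]; ring
  have e2 : ∫ x in P.piece k, u x * conj (P.ell k v x) =
      -((P.ρ k : ℂ) ^ 2) * (∫ x in P.piece k, u x * conj (ψ k x))
        + ∫ x in P.piece k, P.q x * u x * conj (v x) := by
    rw [← integral_const_mul, ← integral_add (i2.const_mul _) i3]
    refine integral_congr_ae ?_
    filter_upwards [hv.ell_ae k] with x hx
    rw [hx]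
    simp only [map_add, map_mul, map_neg, map_pow, Complex.conj_ofReal]
    ring
  have hρ := ρ_ne_zero (P := P) k
  simp only [bracketL, bracketR]
  change (∫ x in P.piece k, φ k x * conj (v x)) - ∫ x in P.piece k, u x * conj (ψ k x) = _ at hg
  rw [e1, e2]
  push_cast
  field_simp
  linear_combination (-(P.thetaProd k : ℂ) * (P.ρ k : ℂ) ^ 2) * hg

/-- The factors of `thetaProd` that do not belong to the `i`-th interior point. -/
def thetaRest (P : TransmissionProblem n) (i : Fin n) : ℝ :=
  (∏ j : Fin n with j.val < i.val, P.θ j 0 1) * ∏ j : Fin n with i.val < j.val, P.θ j 2 3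

theorem thetaRest_pos (i : Fin n) : 0 < P.thetaRest i :=
  mul_pos (Finset.prod_pos fun i _ => P.θ_pos i (by decide))
    (Finset.prod_pos fun i _ => P.θ_pos i (by decide))

/-- The pieces on the two sides of an interior point have weights with a common factor `thetaRest`;
only the minor belonging to that point differs. This lets the two brackets there be collected into
one `jump`. -/
theorem thetaProd_castSucc (i : Fin n) : P.thetaProd i.castSucc = P.thetaRest i * P.θ i 2 3 := by
  have h : (Finset.univ.filter fun j : Fin n => i.castSucc.val ≤ j.val) =
      insert i (Finset.univ.filter fun j : Fin n => i.val < j.val) := by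
    ext j
    simp only [Finset.mem_filter, Finset.mem_univ, true_and, Finset.mem_insert, Fin.val_castSucc,
      Fin.ext_iff]
    omega
  rw [thetaProd, h, Finset.prod_insert (by simp), thetaRest]
  simp only [Fin.val_castSucc]
  ring

theorem thetaProd_succ (i : Fin n) : P.thetaProd i.succ = P.thetaRest i * P.θ i 0 1 := by
  have h : (Finset.univ.filter fun j : Fin n => j.val < i.succ.val) =
      insert i (Finset.univ.filter fun j : Fin n => j.val < i.val) := by
    ext j
    simp only [Finset.mem_filter, Finset.mem_univ, true_and, Finset.mem_insert, Fin.val_succ,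
      Fin.ext_iff]
    omega
  have h' : (Finset.univ.filter fun j : Fin n => i.succ.val ≤ j.val) =
      Finset.univ.filter fun j : Fin n => i.val < j.val := by
    ext j
    simp only [Finset.mem_filter, Finset.mem_univ, true_and, Fin.val_succ]
    omega
  rw [thetaProd, h, h', Finset.prod_insert (by simp), thetaRest]
  ring

theorem thetaProd_zero : P.thetaProd 0 = ∏ i, P.θ i 2 3 := by
  simp [thetaProd]

theorem thetaProd_last : P.thetaProd (Fin.last n) = ∏ i, P.θ i 0 1 := by
  have h : (Finset.univ.filter fun j : Fin n => n ≤ j.val) = ∅ := by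
    ext j
    simp
  simp [thetaProd, h]

/-- The boundary form at the `i`-th interior point. -/
def jump (P : TransmissionProblem n) (i : Fin n) (u v : ℝ → ℂ) : ℂ :=
  P.θ i 2 3 * bracketL u v (P.pt i) - P.θ i 0 1 * bracketR u v (P.pt i)

/-- Green's formula on `Ω`. -/
theorem green (hu : P.Regular u φ) (hv : P.Regular v ψ) :
    (∑ k, ((1 / P.ρ k ^ 2 * P.thetaProd k : ℝ) : ℂ) *
        ∫ x in P.piece k, P.ell k u x * conj (v x))
      - ∑ k, ((1 / P.ρ k ^ 2 * P.thetaProd k : ℝ) : ℂ) *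
        (∫ x in P.piece k, u x * conj (P.ell k v x))
      = (∏ i, P.θ i 2 3 : ℝ) * bracketR u v P.a - (∏ i, P.θ i 0 1 : ℝ) * bracketL u v P.b
        - ∑ i, P.thetaRest i * P.jump i u v := by
  -- The left end of the first piece and the right end of the last are split off. The other ends
  -- pair up: the `i`-th interior point closes piece `i.castSucc` and opens piece `i.succ`.
  rw [← Finset.sum_sub_distrib, Finset.sum_congr rfl fun k _ => green_piece hu hv k,
    Finset.sum_sub_distrib, Fin.sum_univ_succ, Fin.sum_univ_castSucc, thetaProd_zero,
    thetaProd_last]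
  have h : ∑ i, (P.thetaRest i : ℂ) * P.jump i u v =
      ∑ i : Fin n, (P.thetaProd i.castSucc : ℂ) * bracketL u v (P.ξ i.castSucc.succ)
        - ∑ i : Fin n, (P.thetaProd i.succ : ℂ) * bracketR u v (P.ξ i.succ.castSucc) := by
    rw [← Finset.sum_sub_distrib]
    refine Finset.sum_congr rfl fun i _ => ?_
    rw [thetaProd_castSucc, thetaProd_succ, jump, pt, ← Fin.succ_castSucc]
    push_cast
    ring
  rw [h]
  simp only [a, b, Fin.castSucc_zero, Fin.succ_last]
  ring

theorem θ_zero_one (i : Fin n) : P.θ i 0 1 = P.δp1 i * P.γp0 i - P.δp0 i * P.γp1 i := by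
  simp [θ, transMatrix, Matrix.det_fin_two]

theorem θ_two_three (i : Fin n) : P.θ i 2 3 = P.δm1 i * P.γm0 i - P.δm0 i * P.γm1 i := by
  simp [θ, transMatrix, Matrix.det_fin_two]

theorem κ₁_eq : P.κ₁ = P.δ₃ * P.δ₂ - P.δ₄ * P.δ₁ := by simp [κ₁, Matrix.det_fin_two]

theorem κ₂_eq : P.κ₂ = P.γ₃ * P.γ₂ - P.γ₄ * P.γ₁ := by simp [κ₂, Matrix.det_fin_two]

/-- The bracket is the determinant of the matrix with columns `(u', u)` and `(v̄', v̄)`. Let `M₋`,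
`M₊` be the left and right coefficient matrices, with determinants `θ i 2 3` and `θ i 0 1`. The
conditions say that `M₋` applied to the left data is minus `M₊` applied to the right data, also for
`v̄` since the coefficients are real. Taking determinants, the sign disappears in dimension two. -/
theorem jump_eq_zero {i : Fin n} (hu1 : P.transδ i u = 0) (hu2 : P.transγ i u = 0)
    (hv1 : P.transδ i v = 0) (hv2 : P.transγ i v = 0) : P.jump i u v = 0 := by
  have hv1' := congrArg conj hv1
  have hv2' := congrArg conj hv2
  simp only [transδ, transγ, map_add, map_mul, map_zero, Complex.conj_ofReal] at *
  rw [jump, θ_zero_one, θ_two_three, bracketL, bracketR]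
  generalize Function.leftLim (deriv u) (P.pt i) = u1 at *
  generalize Function.leftLim u (P.pt i) = u2 at *
  generalize Function.rightLim (deriv u) (P.pt i) = u3 at *
  generalize Function.rightLim u (P.pt i) = u4 at *
  generalize conj (Function.leftLim (deriv v) (P.pt i)) = v1 at *
  generalize conj (Function.leftLim v (P.pt i)) = v2 at *
  generalize conj (Function.rightLim (deriv v) (P.pt i)) = v3 at *
  generalize conj (Function.rightLim v (P.pt i)) = v4 at *
  push_cast
  linear_combination (P.δm1 i * u1 + P.δm0 i * u2) * hv2' - (P.γp1 i * v3 + P.γp0 i * v4) * hu1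
    - (P.γm1 i * u1 + P.γm0 i * u2) * hv1' + (P.δp1 i * v3 + P.δp0 i * v4) * hu2

/-- Multiplicativity of the determinant again, now for the coefficient matrix of `B` and `B'`. This
turns boundary terms into scalar components of the inner product; the opposite signs of the boundary
terms at `a` and `b` are matched by the sign in `f₂ = -B_b'[f]`. -/
theorem bracket_a : P.Ba u * conj (P.Ba' v) - P.Ba' u * conj (P.Ba v) =
    -(P.κ₁ * bracketR u v P.a) := by
  simp only [Ba, Ba', bracketR, κ₁_eq, map_sub, map_mul, Complex.conj_ofReal]
  push_cast
  ring

theorem bracket_b : P.Bb u * conj (P.Bb' v) - P.Bb' u * conj (P.Bb v) =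
    -(P.κ₂ * bracketL u v P.b) := by
  simp only [Bb, Bb', bracketL, κ₂_eq, map_sub, map_mul, Complex.conj_ofReal]
  push_cast
  ring

end Green

/-! ### Symmetry -/

theorem inner_of_ae {F G : P.H} {f g : Fin (n + 1) → ℝ → ℂ}
    (hF : ∀ k, fn F k =ᵐ[P.pieceMeasure k] f k) (hG : ∀ k, fn G k =ᵐ[P.pieceMeasure k] g k) :
    inner ℂ G F =
      (∑ k, ((1 / P.ρ k ^ 2 * P.thetaProd k : ℝ) : ℂ) *
        ∫ x in P.piece k, f k x * conj (g k x))
      + (((∏ i, P.θ i 2 3) / P.κ₁ : ℝ) : ℂ) * (cA F * conj (cA G))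
      + (((∏ i, P.θ i 0 1) / P.κ₂ : ℝ) : ℂ) * (cB F * conj (cB G)) := by
  rw [inner_eq]
  congr 2
  refine Finset.sum_congr rfl fun k _ => ?_
  congr 1
  refine integral_congr_ae ?_
  filter_upwards [hF k, hG k] with x h1 h2
  rw [h1, h2]

theorem Represents.fn_image {u : ℝ → ℂ} {F : P.H} (h : P.Represents u F) (k : Fin (n + 1)) :
    fn h.image k =ᵐ[P.pieceMeasure k] P.ell k u :=
  (h.ell_memLp k).coeFn_toLp

theorem cA_image {u : ℝ → ℂ} {F : P.H} (h : P.Represents u F) : cA h.image = P.Ba u := rfl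

theorem cB_image {u : ℝ → ℂ} {F : P.H} (h : P.Represents u F) : cB h.image = P.Bb u := rfl

theorem κ₁_ne_zero : (P.κ₁ : ℂ) ≠ 0 := by exact_mod_cast (show 0 < P.κ₁ from P.κ₁_pos).ne'

theorem κ₂_ne_zero : (P.κ₂ : ℂ) ≠ 0 := by exact_mod_cast (show 0 < P.κ₂ from P.κ₂_pos).ne'

theorem inner_image_left {u v : ℝ → ℂ} {F G : P.H} (hu : P.Represents u F)
    (hv : P.Represents v G) : inner ℂ hv.image F = inner ℂ G hu.image := by
  rw [inner_of_ae hu.fn_image hv.fn_eq, inner_of_ae hu.fn_eq hv.fn_image]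
  have hg := green hu.regular hv.regular
  rw [Finset.sum_eq_zero (s := Finset.univ) (f := fun i => (P.thetaRest i : ℂ) * P.jump i u v)
    fun i _ => by
      rw [jump_eq_zero (hu.trans₁ i) (hu.trans₂ i) (hv.trans₁ i) (hv.trans₂ i), mul_zero]] at hg
  simp only [cA_image, cB_image, hu.cA_eq, hu.cB_eq, hv.cA_eq, hv.cB_eq, map_neg]
  have h1 := bracket_a (P := P) (u := u) (v := v)
  have h2 := bracket_b (P := P) (u := u) (v := v)
  have k1 := κ₁_ne_zero (P := P)
  have k2 := κ₂_ne_zero (P := P)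
  rw [Complex.ofReal_div, Complex.ofReal_div]
  have e1 : bracketR u v P.a = -(P.Ba u * conj (P.Ba' v) - P.Ba' u * conj (P.Ba v)) / P.κ₁ := by
    rw [h1]; field_simp
  have e2 : bracketL u v P.b = -(P.Bb u * conj (P.Bb' v) - P.Bb' u * conj (P.Bb v)) / P.κ₂ := by
    rw [h2]; field_simp
  rw [e1, e2] at hg
  linear_combination -hg

theorem isFormalAdjoint_R : P.R.IsFormalAdjoint P.R := by
  intro G F
  obtain ⟨v, hv⟩ := G.2
  obtain ⟨u, hu⟩ := F.2
  rw [R_apply G hv, R_apply F hu]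
  exact inner_image_left hu hv

/-! ### Construction of functions in the domain -/

/-- The function that agrees with `u k` on the `k`-th piece. -/
def glue (P : TransmissionProblem n) (u : Fin (n + 1) → ℝ → ℂ) (x : ℝ) : ℂ :=
  ∑ k, (P.piece k).indicator (u k) x

theorem eq_of_mem_piece {j k : Fin (n + 1)} {x : ℝ} (hj : x ∈ P.piece j) (hk : x ∈ P.piece k) :
    j = k := by
  have aux : ∀ {j k : Fin (n + 1)}, x ∈ P.piece j → x ∈ P.piece k → ¬ j < k := by
    intro j k hj hk hjk
    have h : P.ξ j.succ ≤ P.ξ k.castSucc := P.ξ_strictMono.monotone (by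
      rw [Fin.le_def]; simpa using hjk)
    exact absurd (hj.2.trans_le h) hk.1.le.not_gt
  exact le_antisymm (not_lt.1 (aux hk hj)) (not_lt.1 (aux hj hk))

theorem eqOn_glue (u : Fin (n + 1) → ℝ → ℂ) (k : Fin (n + 1)) :
    EqOn (P.glue u) (u k) (P.piece k) := by
  intro x hx
  rw [glue, Finset.sum_eq_single k, indicator_of_mem hx]
  · intro j _ hj
    exact indicator_of_notMem (fun h => hj (eq_of_mem_piece h hx)) _
  · simp

/-- The one-sided limits of `u` and `u'` at the end points of the pieces. -/
structure HasBoundaryValues (P : TransmissionProblem n) (u : ℝ → ℂ)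
    (α β α' β' : Fin (n + 1) → ℂ) : Prop where
  right : ∀ k : Fin (n + 1), Function.rightLim u (P.ξ k.castSucc) = α k
  right_deriv : ∀ k : Fin (n + 1), Function.rightLim (deriv u) (P.ξ k.castSucc) = β k
  left : ∀ k : Fin (n + 1), Function.leftLim u (P.ξ k.succ) = α' k
  left_deriv : ∀ k : Fin (n + 1), Function.leftLim (deriv u) (P.ξ k.succ) = β' k

theorem exists_regular {φ u : Fin (n + 1) → ℝ → ℂ} {α β : Fin (n + 1) → ℂ}
    (h : ∀ k, IsTwicePrim (P.ξ k.castSucc) (P.ξ k.succ) (α k) (β k) (φ k) (u k)) :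
    P.Regular (P.glue u) φ ∧
      P.HasBoundaryValues (P.glue u) α β
        (fun k => prim (P.ξ k.castSucc) (α k) (prim (P.ξ k.castSucc) (β k) (φ k)) (P.ξ k.succ))
        (fun k => prim (P.ξ k.castSucc) (β k) (φ k) (P.ξ k.succ)) := by
  have h' k := (h k).congr (eqOn_glue u k)
  exact ⟨fun k => ⟨_, _, h' k⟩, fun k => (h' k).rightLim_eq (ξ_lt k),
    fun k => (h' k).rightLim_deriv (ξ_lt k), fun k => (h' k).leftLim_eq (ξ_lt k),
    fun k => (h' k).leftLim_deriv (ξ_lt k)⟩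

/-- The supply of test functions: the data at the two ends of every piece are independent of each
other, so each condition on the adjoint can be isolated. -/
theorem exists_regular_boundaryValues (P : TransmissionProblem n) (α β α' β' : Fin (n + 1) → ℂ) :
    ∃ u φ, P.Regular u φ ∧ P.HasBoundaryValues u α β α' β' := by
  choose φ u h hα hβ using fun k =>
    IsTwicePrim.exists_boundary (ξ_lt (P := P) k) (α k) (β k) (α' k) (β' k)
  obtain ⟨h1, h2⟩ := exists_regular h
  simp only [hα, hβ] at h2
  exact ⟨_, _, h1, h2⟩

namespace HasBoundaryValues

variable {u : ℝ → ℂ} {α β α' β' : Fin (n + 1) → ℂ}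

theorem right_a (h : P.HasBoundaryValues u α β α' β') : Function.rightLim u P.a = α 0 :=
  h.right 0

theorem right_deriv_a (h : P.HasBoundaryValues u α β α' β') :
    Function.rightLim (deriv u) P.a = β 0 :=
  h.right_deriv 0

theorem left_b (h : P.HasBoundaryValues u α β α' β') :
    Function.leftLim u P.b = α' (Fin.last n) :=
  h.left (Fin.last n)

theorem left_deriv_b (h : P.HasBoundaryValues u α β α' β') :
    Function.leftLim (deriv u) P.b = β' (Fin.last n) :=
  h.left_deriv (Fin.last n)

theorem right_pt (h : P.HasBoundaryValues u α β α' β') (i : Fin n) :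
    Function.rightLim u (P.pt i) = α i.succ :=
  h.right i.succ

theorem right_deriv_pt (h : P.HasBoundaryValues u α β α' β') (i : Fin n) :
    Function.rightLim (deriv u) (P.pt i) = β i.succ :=
  h.right_deriv i.succ

theorem left_pt (h : P.HasBoundaryValues u α β α' β') (i : Fin n) :
    Function.leftLim u (P.pt i) = α' i.castSucc :=
  h.left i.castSucc

theorem left_deriv_pt (h : P.HasBoundaryValues u α β α' β') (i : Fin n) :
    Function.leftLim (deriv u) (P.pt i) = β' i.castSucc :=
  h.left_deriv i.castSucc

end HasBoundaryValues

/-! ### Maximality -/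

section Maximality

variable {G K : P.H}

/-- The hypothesis `h` puts `(G, K)` in the graph of the adjoint relation, without mentioning the
adjoint operator; it therefore makes sense before density is known. -/
theorem inner_eq_of_regular
    (h : ∀ u F, ∀ hu : P.Represents u F, inner ℂ G hu.image = inner ℂ K F)
    {u : ℝ → ℂ} {φ : Fin (n + 1) → ℝ → ℂ} (hu : P.Regular u φ) (h1 : ∀ i, P.transδ i u = 0)
    (h2 : ∀ i, P.transγ i u = 0) {g f : Fin (n + 1) → ℝ → ℂ}
    (hG : ∀ k, fn G k =ᵐ[P.pieceMeasure k] g k) (hK : ∀ k, fn K k =ᵐ[P.pieceMeasure k] f k) :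
    (∑ k, ((1 / P.ρ k ^ 2 * P.thetaProd k : ℝ) : ℂ) *
        ∫ x in P.piece k, P.ell k u x * conj (g k x))
      + (((∏ i, P.θ i 2 3) / P.κ₁ : ℝ) : ℂ) * (P.Ba u * conj (cA G))
      + (((∏ i, P.θ i 0 1) / P.κ₂ : ℝ) : ℂ) * (P.Bb u * conj (cB G)) =
    (∑ k, ((1 / P.ρ k ^ 2 * P.thetaProd k : ℝ) : ℂ) *
        ∫ x in P.piece k, u x * conj (f k x))
      + (((∏ i, P.θ i 2 3) / P.κ₁ : ℝ) : ℂ) * (P.Ba' u * conj (cA K))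
      + (((∏ i, P.θ i 0 1) / P.κ₂ : ℝ) : ℂ) * (-P.Bb' u * conj (cB K)) := by
  obtain ⟨F, hF⟩ := hu.exists_represents h1 h2
  have := h u F hF
  rwa [inner_of_ae hF.fn_image hG, inner_of_ae hF.fn_eq hK, cA_image, cB_image, hF.cA_eq,
    hF.cB_eq] at this

/-- Elements in the domain of the adjoint satisfy the differential equation. -/
theorem exists_regular_of_adjoint
    (h : ∀ u F, ∀ hu : P.Represents u F, inner ℂ G hu.image = inner ℂ K F) :
    ∃ v ψ, P.Regular v ψ ∧ (∀ k, fn G k =ᵐ[P.pieceMeasure k] v) ∧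
      ∀ k, fn K k =ᵐ[P.pieceMeasure k] P.ell k v := by
  -- The right-hand side is `ℓ g = K` solved for `g''`.
  have main (k : Fin (n + 1)) : ∃ α β φ v,
      IsTwicePrim (P.ξ k.castSucc) (P.ξ k.succ) α β φ v ∧
      φ =ᵐ[P.pieceMeasure k] (fun x => ((P.ρ k : ℂ) ^ 2)⁻¹ * (P.q x * fn G k x - fn K k x)) ∧
      fn G k =ᵐ[P.pieceMeasure k] v := by
    have mG : MemLp (fn G k) 2 (P.pieceMeasure k) := Lp.memLp _
    have mK : MemLp (fn K k) 2 (P.pieceMeasure k) := Lp.memLp _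
    refine exists_isTwicePrim_of_weak (ξ_lt k) mG
      (((memLp_q_mul mG).sub mK).const_mul (((P.ρ k : ℂ) ^ 2)⁻¹)) fun φ u hu e1 e2 => ?_
    -- The test function is extended by zero to the other pieces. All its one-sided boundary values
    -- vanish, so it satisfies the transmission conditions and only the integrals over piece `k`
    -- survive.
    have hpieces : ∀ j : Fin (n + 1), IsTwicePrim (P.ξ j.castSucc) (P.ξ j.succ) 0 0
        ((if j = k then φ else fun _ => 0) : ℝ → ℂ) (if j = k then u else fun _ => 0) := by
      intro j
      by_cases hj : j = k
      · subst hj; simpa using hu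
      · simpa [hj] using IsTwicePrim.zero
    obtain ⟨hreg, hbv⟩ := exists_regular hpieces
    set w := P.glue fun j => if j = k then u else fun _ => 0 with hw
    have z1 : ∀ j : Fin (n + 1), prim (P.ξ j.castSucc) 0 (prim (P.ξ j.castSucc) 0
        ((if j = k then φ else fun _ => 0) : ℝ → ℂ)) (P.ξ j.succ) = 0 := by
      intro j
      by_cases hj : j = k
      · subst hj; simpa using e1
      · simp [hj, prim]
    have z2 : ∀ j : Fin (n + 1), prim (P.ξ j.castSucc) 0
        ((if j = k then φ else fun _ => 0) : ℝ → ℂ) (P.ξ j.succ) = 0 := by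
      intro j
      by_cases hj : j = k
      · subst hj; simpa using e2
      · simp [hj, prim]
    simp only [z1, z2] at hbv
    have key := inner_eq_of_regular h hreg
      (fun i => by simp [transδ, hbv.right_pt, hbv.right_deriv_pt, hbv.left_pt, hbv.left_deriv_pt])
      (fun i => by simp [transγ, hbv.right_pt, hbv.right_deriv_pt, hbv.left_pt, hbv.left_deriv_pt])
      (fun k => EventuallyEq.rfl) (fun k => EventuallyEq.rfl)
    simp only [Ba, Ba', Bb, Bb', hbv.right_a, hbv.right_deriv_a, hbv.left_b, hbv.left_deriv_b,
      mul_zero, sub_zero, neg_zero, zero_mul, add_zero] at key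
    rw [Finset.sum_eq_single k, Finset.sum_eq_single k] at key
    · have hwk : EqOn w u (P.piece k) := fun x hx => by
        rw [hw, eqOn_glue _ k hx]; simp
      have hρ := ρ_ne_zero (P := P) k
      have hc : ((1 / P.ρ k ^ 2 * P.thetaProd k : ℝ) : ℂ) ≠ 0 := by
        exact_mod_cast (P.weight k).2.ne'
      have key' := mul_left_cancel₀ hc key
      have mu : MemLp u 2 (P.pieceMeasure k) := hu.memLp_two (ξ_lt k)
      have i1 : Integrable (fun x => φ x * conj (fn G k x)) (P.pieceMeasure k) :=
        hu.memLp.integrable_mul mG.star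
      have i2 : Integrable (fun x => P.q x * u x * conj (fn G k x)) (P.pieceMeasure k) :=
        (memLp_q_mul mu).integrable_mul mG.star
      have i3 : Integrable (fun x => u x * conj (fn K k x)) (P.pieceMeasure k) :=
        mu.integrable_mul mK.star
      have l1 : ∫ x in P.piece k, P.ell k w x * conj (fn G k x) =
          -((P.ρ k : ℂ) ^ 2) * (∫ x in P.piece k, φ x * conj (fn G k x))
            + ∫ x in P.piece k, P.q x * u x * conj (fn G k x) := by
        rw [← integral_const_mul, ← integral_add (i1.const_mul _) i2]
        refine integral_congr_ae ?_
        filter_upwards [hreg.ell_ae k, ae_restrict_mem measurableSet_Ioo] with x hx hx'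
        rw [hx, hwk hx', if_pos rfl]; ring
      have l2 : ∫ x in P.piece k, w x * conj (fn K k x) =
          ∫ x in P.piece k, u x * conj (fn K k x) :=
        setIntegral_congr_fun measurableSet_Ioo fun x hx => by simp only [hwk hx]
      have l3 : ∫ x in P.piece k,
          u x * conj (((P.ρ k : ℂ) ^ 2)⁻¹ * (P.q x * fn G k x - fn K k x)) =
          ((P.ρ k : ℂ) ^ 2)⁻¹ * ((∫ x in P.piece k, P.q x * u x * conj (fn G k x))
            - ∫ x in P.piece k, u x * conj (fn K k x)) := by
        rw [← integral_sub i2 i3, ← integral_const_mul]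
        refine integral_congr_ae (Eventually.of_forall fun x => ?_)
        simp only [map_mul, map_sub, map_inv₀, map_pow, Complex.conj_ofReal]
        ring
      change ∫ x in P.piece k, φ x * conj (fn G k x) = ∫ x in P.piece k,
          u x * conj (((P.ρ k : ℂ) ^ 2)⁻¹ * (P.q x * fn G k x - fn K k x))
      rw [l1, l2] at key'
      rw [l3, ← key']
      field_simp
      ring
    · intro j _ hj
      rw [integral_congr_ae (g := fun _ => 0), integral_zero, mul_zero]
      filter_upwards [ae_restrict_mem measurableSet_Ioo] with x hx
      have : w x = 0 := by rw [hw, eqOn_glue _ j hx]; simp [hj]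
      rw [this, zero_mul]
    · simp
    · intro j _ hj
      rw [integral_congr_ae (g := fun _ => 0), integral_zero, mul_zero]
      filter_upwards [hreg.ell_ae j, ae_restrict_mem measurableSet_Ioo] with x hx hx'
      have : w x = 0 := by rw [hw, eqOn_glue _ j hx']; simp [hj]
      rw [hx, this]
      simp [hj]
    · simp
  choose α β φ v hv hφ hG using main
  have hreg := (exists_regular hv).1
  have hG' : ∀ k, fn G k =ᵐ[P.pieceMeasure k] P.glue v := by
    intro k
    filter_upwards [hG k, ae_restrict_mem measurableSet_Ioo] with x h1 h2
    rw [h1, eqOn_glue v k h2]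
  refine ⟨_, _, hreg, hG', fun k => ?_⟩
  filter_upwards [hreg.ell_ae k, hφ k, hG' k] with x h1 h2 h3
  have hρ := ρ_ne_zero (P := P) k
  rw [h1, h2, h3]
  field_simp
  ring

/-! ### Boundary and transmission conditions for the adjoint. -/

variable {v : ℝ → ℂ} {ψ : Fin (n + 1) → ℝ → ℂ}

/-- Subtracting Green's formula from the adjoint identity removes every integral. -/
theorem boundary_form_eq_zero
    (h : ∀ u F, ∀ hu : P.Represents u F, inner ℂ G hu.image = inner ℂ K F)
    (hv : P.Regular v ψ) (hG : ∀ k, fn G k =ᵐ[P.pieceMeasure k] v)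
    (hK : ∀ k, fn K k =ᵐ[P.pieceMeasure k] P.ell k v)
    {u : ℝ → ℂ} {φ : Fin (n + 1) → ℝ → ℂ} (hu : P.Regular u φ) (h1 : ∀ i, P.transδ i u = 0)
    (h2 : ∀ i, P.transγ i u = 0) :
    ((∏ i, P.θ i 2 3) / P.κ₁ : ℝ) *
        (P.κ₁ * bracketR u v P.a + P.Ba u * conj (cA G) - P.Ba' u * conj (cA K))
      + ((∏ i, P.θ i 0 1) / P.κ₂ : ℝ) *
        (-(P.κ₂ * bracketL u v P.b) + P.Bb u * conj (cB G) + P.Bb' u * conj (cB K))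
      - ∑ i, P.thetaRest i * P.jump i u v = 0 := by
  have e1 := inner_eq_of_regular h hu h1 h2 hG hK
  have e2 := green hu hv
  have k1 := κ₁_ne_zero (P := P)
  have k2 := κ₂_ne_zero (P := P)
  have e3 : (((∏ i, P.θ i 2 3 : ℝ) / P.κ₁ : ℝ) : ℂ) * P.κ₁ = (∏ i, P.θ i 2 3 : ℝ) := by
    rw [Complex.ofReal_div]; field_simp
  have e4 : (((∏ i, P.θ i 0 1 : ℝ) / P.κ₂ : ℝ) : ℂ) * P.κ₂ = (∏ i, P.θ i 0 1 : ℝ) := by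
    rw [Complex.ofReal_div]; field_simp
  linear_combination e1 - e2 + bracketR u v P.a * e3 - bracketL u v P.b * e4

/-- The test function has Cauchy data `(x, x')` on the left and `(y, y')` on the right of one
interior point and zero data at all other ends. -/
theorem jump_test
    (h : ∀ u F, ∀ hu : P.Represents u F, inner ℂ G hu.image = inner ℂ K F)
    (hv : P.Regular v ψ) (hG : ∀ k, fn G k =ᵐ[P.pieceMeasure k] v)
    (hK : ∀ k, fn K k =ᵐ[P.pieceMeasure k] P.ell k v) (i : Fin n) {x x' y y' : ℂ}
    (h1 : P.δm1 i * x' + P.δm0 i * x + P.δp1 i * y' + P.δp0 i * y = 0)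
    (h2 : P.γm1 i * x' + P.γm0 i * x + P.γp1 i * y' + P.γp0 i * y = 0) :
    P.θ i 2 3 * (x' * conj (Function.leftLim v (P.pt i))
        - x * conj (Function.leftLim (deriv v) (P.pt i)))
      - P.θ i 0 1 * (y' * conj (Function.rightLim v (P.pt i))
        - y * conj (Function.rightLim (deriv v) (P.pt i))) = 0 := by
  obtain ⟨u, φ, hu, hb⟩ := P.exists_regular_boundaryValues (Pi.single i.succ y)
    (Pi.single i.succ y') (Pi.single i.castSucc x) (Pi.single i.castSucc x')
  have t1 (j : Fin n) : P.transδ j u = 0 := by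
    rw [transδ, hb.right_pt, hb.right_deriv_pt, hb.left_pt, hb.left_deriv_pt]
    by_cases hj : j = i
    · subst hj; simpa using h1
    · simp [hj]
  have t2 (j : Fin n) : P.transγ j u = 0 := by
    rw [transγ, hb.right_pt, hb.right_deriv_pt, hb.left_pt, hb.left_deriv_pt]
    by_cases hj : j = i
    · subst hj; simpa using h2
    · simp [hj]
  have key := boundary_form_eq_zero h hv hG hK hu t1 t2
  rw [Finset.sum_eq_single i] at key
  · simp only [Ba, Ba', Bb, Bb', bracketL, bracketR, jump, hb.right_a, hb.right_deriv_a, hb.left_b,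
      hb.left_deriv_b, hb.right_pt, hb.right_deriv_pt, hb.left_pt, hb.left_deriv_pt] at key
    have hr : (P.thetaRest i : ℂ) ≠ 0 := by exact_mod_cast (thetaRest_pos i).ne'
    have z1 : ∀ z : ℂ, (Pi.single i.succ z : Fin (n + 1) → ℂ) 0 = 0 := fun z =>
      Pi.single_eq_of_ne (Fin.succ_ne_zero i).symm z
    have z2 : ∀ z : ℂ, (Pi.single i.castSucc z : Fin (n + 1) → ℂ) (Fin.last n) = 0 := fun z => by
      simp [(Fin.castSucc_ne_last i).symm]
    simp only [z1, z2, Pi.single_eq_same, zero_mul, mul_zero, sub_zero, add_zero, neg_zero,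
      zero_sub, neg_eq_zero] at key
    exact (mul_eq_zero.1 key).resolve_left hr
  · intro j _ hj
    simp only [jump, bracketL, bracketR, hb.right_pt, hb.right_deriv_pt, hb.left_pt,
      hb.left_deriv_pt]
    simp [hj]
  · simp

theorem θ_ne_zero (i : Fin n) {j k : Fin 4} (h : j < k) : (P.θ i j k : ℂ) ≠ 0 := by
  exact_mod_cast (P.θ_pos i h).ne'

/-- Elements in the domain of the adjoint satisfy the transmission conditions. -/
theorem trans_of_adjoint
    (h : ∀ u F, ∀ hu : P.Represents u F, inner ℂ G hu.image = inner ℂ K F)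
    (hv : P.Regular v ψ) (hG : ∀ k, fn G k =ᵐ[P.pieceMeasure k] v)
    (hK : ∀ k, fn K k =ᵐ[P.pieceMeasure k] P.ell k v) (i : Fin n) :
    P.transδ i v = 0 ∧ P.transγ i v = 0 := by
  have n1 : (P.θ i 0 1 : ℂ) ≠ 0 := θ_ne_zero i (by decide)
  have n2 : (P.θ i 2 3 : ℂ) ≠ 0 := θ_ne_zero i (by decide)
  have e1 : (P.θ i 0 1 : ℂ) = P.δp1 i * P.γp0 i - P.δp0 i * P.γp1 i := by
    rw [θ_zero_one]; push_cast; rfl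
  have e2 : (P.θ i 2 3 : ℂ) = P.δm1 i * P.γm0 i - P.δm0 i * P.γm1 i := by
    rw [θ_two_three]; push_cast; rfl
  constructor
  -- The data come from the `δ` row, rotated by a right angle and divided by the minors. Each side
  -- annihilates the `δ` row; the `γ` row gives `1` from the left and `-1` from the right. The
  -- resulting form is minus the conjugate of `transδ i v`.
  · have key := jump_test h hv hG hK i (x := P.δm1 i / P.θ i 2 3) (x' := -(P.δm0 i / P.θ i 2 3))
      (y := -(P.δp1 i / P.θ i 0 1)) (y' := P.δp0 i / P.θ i 0 1) (by field_simp; ring)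
      (by field_simp; rw [e1, e2]; ring)
    rw [← map_eq_zero conj, transδ]
    simp only [map_add, map_mul, Complex.conj_ofReal]
    field_simp at key
    linear_combination -key
  -- The same choice with the `γ` row in place of the `δ` row.
  · have key := jump_test h hv hG hK i (x := P.γm1 i / P.θ i 2 3) (x' := -(P.γm0 i / P.θ i 2 3))
      (y := -(P.γp1 i / P.θ i 0 1)) (y' := P.γp0 i / P.θ i 0 1)
      (by field_simp; rw [e1, e2]; ring) (by field_simp; ring)
    rw [← map_eq_zero conj, transγ]
    simp only [map_add, map_mul, Complex.conj_ofReal]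
    field_simp at key
    linear_combination -key

/-- Elements in the domain of the adjoint satisfy the boundary conditions at `a`. -/
theorem left_of_adjoint
    (h : ∀ u F, ∀ hu : P.Represents u F, inner ℂ G hu.image = inner ℂ K F)
    (hv : P.Regular v ψ) (hG : ∀ k, fn G k =ᵐ[P.pieceMeasure k] v)
    (hK : ∀ k, fn K k =ᵐ[P.pieceMeasure k] P.ell k v) :
    cA G = P.Ba' v ∧ cA K = P.Ba v := by
  have k1 := κ₁_ne_zero (P := P)
  have hκ : (P.κ₁ : ℂ) = P.δ₃ * P.δ₂ - P.δ₄ * P.δ₁ := by rw [κ₁_eq]; push_cast; rfl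
  have main (y y' : ℂ) : (P.δ₁ * y - P.δ₂ * y') * conj (cA G - P.Ba' v)
      - (P.δ₃ * y - P.δ₄ * y') * conj (cA K - P.Ba v) = 0 := by
    obtain ⟨u, φ, hu, hb⟩ := P.exists_regular_boundaryValues (Pi.single 0 y)
      (Pi.single 0 y') 0 0
    have t1 (j : Fin n) : P.transδ j u = 0 := by
      rw [transδ, hb.right_pt, hb.right_deriv_pt, hb.left_pt, hb.left_deriv_pt]
      simp
    have t2 (j : Fin n) : P.transγ j u = 0 := by
      rw [transγ, hb.right_pt, hb.right_deriv_pt, hb.left_pt, hb.left_deriv_pt]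
      simp
    have key := boundary_form_eq_zero h hv hG hK hu t1 t2
    have hj (j : Fin n) : P.jump j u v = 0 := by
      simp only [jump, bracketL, bracketR, hb.right_pt, hb.right_deriv_pt, hb.left_pt,
        hb.left_deriv_pt]
      simp
    have hL : bracketL u v P.b = 0 := by simp [bracketL, hb.left_b, hb.left_deriv_b]
    have hBb : P.Bb u = 0 := by simp [Bb, hb.left_b, hb.left_deriv_b]
    have hBb' : P.Bb' u = 0 := by simp [Bb', hb.left_b, hb.left_deriv_b]
    have hBa : P.Ba u = P.δ₁ * y - P.δ₂ * y' := by simp [Ba, hb.right_a, hb.right_deriv_a]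
    have hBa' : P.Ba' u = P.δ₃ * y - P.δ₄ * y' := by simp [Ba', hb.right_a, hb.right_deriv_a]
    simp only [hj, hL, hBb, hBb', mul_zero, zero_mul, neg_zero, add_zero,
      Finset.sum_const_zero, sub_zero] at key
    have hne : (((∏ i, P.θ i 2 3) / P.κ₁ : ℝ) : ℂ) ≠ 0 := by exact_mod_cast P.weightA.2.ne'
    have key' := (mul_eq_zero.1 key).resolve_left hne
    have hbr := bracket_a (P := P) (u := u) (v := v)
    rw [← hBa, ← hBa', map_sub, map_sub]
    linear_combination key' - hbr
  constructor
  -- This choice makes `B_a'` of the test function zero and `B_a` equal to `κ₁`.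
  · have := main (-P.δ₄) (-P.δ₃)
    rw [← sub_eq_zero, ← map_eq_zero conj]
    rw [hκ] at k1
    refine (mul_eq_zero.1 (Eq.trans ?_ this)).resolve_left k1
    ring
  -- Here `B_a` vanishes and `B_a'` equals `κ₁`.
  · have := main P.δ₂ P.δ₁
    rw [← sub_eq_zero, ← map_eq_zero conj, ← neg_eq_zero]
    rw [hκ] at k1
    refine (mul_eq_zero.1 (Eq.trans ?_ this)).resolve_left k1
    ring

/-- Elements in the domain of the adjoint satisfy the boundary conditions at `b`. -/
theorem right_of_adjoint
    (h : ∀ u F, ∀ hu : P.Represents u F, inner ℂ G hu.image = inner ℂ K F)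
    (hv : P.Regular v ψ) (hG : ∀ k, fn G k =ᵐ[P.pieceMeasure k] v)
    (hK : ∀ k, fn K k =ᵐ[P.pieceMeasure k] P.ell k v) :
    cB G = -P.Bb' v ∧ cB K = P.Bb v := by
  have k2 := κ₂_ne_zero (P := P)
  have hκ : (P.κ₂ : ℂ) = P.γ₃ * P.γ₂ - P.γ₄ * P.γ₁ := by rw [κ₂_eq]; push_cast; rfl
  have main (y y' : ℂ) : (P.γ₁ * y - P.γ₂ * y') * conj (cB G + P.Bb' v)
      + (P.γ₃ * y - P.γ₄ * y') * conj (cB K - P.Bb v) = 0 := by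
    obtain ⟨u, φ, hu, hb⟩ := P.exists_regular_boundaryValues 0 0 (Pi.single (Fin.last n) y)
      (Pi.single (Fin.last n) y')
    have z (j : Fin n) (w : ℂ) : (Pi.single (Fin.last n) w : Fin (n + 1) → ℂ) j.castSucc = 0 := by
      simp [Fin.castSucc_ne_last j]
    have t1 (j : Fin n) : P.transδ j u = 0 := by
      rw [transδ, hb.right_pt, hb.right_deriv_pt, hb.left_pt, hb.left_deriv_pt, z, z]
      simp
    have t2 (j : Fin n) : P.transγ j u = 0 := by
      rw [transγ, hb.right_pt, hb.right_deriv_pt, hb.left_pt, hb.left_deriv_pt, z, z]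
      simp
    have key := boundary_form_eq_zero h hv hG hK hu t1 t2
    have hj (j : Fin n) : P.jump j u v = 0 := by
      simp only [jump, bracketL, bracketR, hb.right_pt, hb.right_deriv_pt, hb.left_pt,
        hb.left_deriv_pt, z]
      simp
    have hR : bracketR u v P.a = 0 := by simp [bracketR, hb.right_a, hb.right_deriv_a]
    have hBa : P.Ba u = 0 := by simp [Ba, hb.right_a, hb.right_deriv_a]
    have hBa' : P.Ba' u = 0 := by simp [Ba', hb.right_a, hb.right_deriv_a]
    have hBb : P.Bb u = P.γ₁ * y - P.γ₂ * y' := by simp [Bb, hb.left_b, hb.left_deriv_b]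
    have hBb' : P.Bb' u = P.γ₃ * y - P.γ₄ * y' := by simp [Bb', hb.left_b, hb.left_deriv_b]
    simp only [hj, hR, hBa, hBa', mul_zero, zero_mul, add_zero, zero_add,
      Finset.sum_const_zero, sub_zero] at key
    have hne : (((∏ i, P.θ i 0 1) / P.κ₂ : ℝ) : ℂ) ≠ 0 := by exact_mod_cast P.weightB.2.ne'
    have key' := (mul_eq_zero.1 key).resolve_left hne
    have hbr := bracket_b (P := P) (u := u) (v := v)
    rw [← hBb, ← hBb', map_add, map_sub]
    linear_combination key' + hbr
  constructor
  -- As at `a`: first `B_b'` vanishes and `B_b` equals `κ₂`, then the roles are exchanged.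
  · have := main (-P.γ₄) (-P.γ₃)
    rw [← sub_eq_zero, sub_neg_eq_add, ← map_eq_zero conj]
    rw [hκ] at k2
    refine (mul_eq_zero.1 (Eq.trans ?_ this)).resolve_left k2
    ring
  · have := main P.γ₂ P.γ₁
    rw [← sub_eq_zero, ← map_eq_zero conj]
    rw [hκ] at k2
    refine (mul_eq_zero.1 (Eq.trans ?_ this)).resolve_left k2
    ring

/-- The operator extends every operator that is formally adjoint to it. -/
theorem exists_represents_of_adjoint
    (h : ∀ u F, ∀ hu : P.Represents u F, inner ℂ G hu.image = inner ℂ K F) :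
    ∃ v, ∃ hv : P.Represents v G, hv.image = K := by
  obtain ⟨v, ψ, hv, hG, hK⟩ := exists_regular_of_adjoint h
  have ht := trans_of_adjoint h hv hG hK
  obtain ⟨ha, ha'⟩ := left_of_adjoint h hv hG hK
  obtain ⟨hb, hb'⟩ := right_of_adjoint h hv hG hK
  refine ⟨v, hv.represents (fun i => (ht i).1) (fun i => (ht i).2) hG ha hb, ?_⟩
  refine H_ext (fun k => ?_) ha'.symm hb'.symm
  exact Lp.ext ((Represents.fn_image _ k).trans (hK k).symm)

end Maximality

/-! ### Density of the domain and self-adjointness. -/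

theorem isSelfAdjoint_R : IsSelfAdjoint P.R := by
  have max : ∀ G K : P.H, (∀ F : P.R.domain, inner ℂ K (F : P.H) = inner ℂ G (P.R F)) →
      ∃ hG : G ∈ P.R.domain, P.R ⟨G, hG⟩ = K := by
    intro G K h
    obtain ⟨v, hv, hK⟩ := exists_represents_of_adjoint (G := G) (K := K) fun u F hu => by
      have := h ⟨F, ⟨u, hu⟩⟩
      rw [R_apply _ hu] at this
      exact this.symm
    exact ⟨⟨v, hv⟩, by rw [R_apply _ hv, hK]⟩
  have hdense : Dense (P.R.domain : Set P.H) := by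
    rw [Submodule.dense_iff_topologicalClosure_eq_top,
      Submodule.topologicalClosure_eq_top_iff, Submodule.eq_bot_iff]
    intro K hK
    -- For `K` orthogonal to the domain, both sides of the adjoint identity with `G = 0` vanish, so
    -- maximality gives `K = R 0`.
    obtain ⟨h0, h1⟩ := max 0 K fun F => by
      rw [inner_zero_left]
      exact Submodule.inner_left_of_mem_orthogonal F.2 hK
    rw [← h1]
    exact map_zero P.R.toFun
  rw [LinearPMap.isSelfAdjoint_def]
  refine le_antisymm ?_ (isFormalAdjoint_R.le_adjoint hdense)
  have hadj := LinearPMap.adjoint_isFormalAdjoint hdense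
  refine ⟨fun G hG => (max G _ fun F => hadj ⟨G, hG⟩ F).1, ?_⟩
  rintro ⟨G, hG⟩ ⟨G', hG'⟩ (rfl : G = G')
  exact (max G _ fun F => hadj ⟨G, hG⟩ F).2.symm

/-! ### Eigenvalues -/

section Eigenvalues

variable {u : ℝ → ℂ} {F : P.H} {lam : ℂ}

/-- The right-hand side of the equation `u'' = ρ⁻² (q - λ) u`. -/
def secondRHS (P : TransmissionProblem n) (k : Fin (n + 1)) (lam : ℂ) (u : ℝ → ℂ) (x : ℝ) : ℂ :=
  ((P.ρ k : ℂ) ^ 2)⁻¹ * (P.q x * u x - lam * u x)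

theorem ell_eq_iff {k : Fin (n + 1)} {x : ℝ} :
    P.ell k u x = lam * u x ↔ deriv (deriv u) x = P.secondRHS k lam u x := by
  have hρ := ρ_ne_zero (P := P) k
  rw [ell, secondRHS, eq_inv_mul_iff_mul_eq₀ (pow_ne_zero 2 hρ)]
  constructor <;> intro h <;> linear_combination -h

theorem continuousOn_secondRHS {k : Fin (n + 1)} (hu : ContinuousOn u (P.piece k)) :
    ContinuousOn (P.secondRHS k lam u) (P.piece k) :=
  continuousOn_const.mul (((q_continuousOn_complex k).mul hu).sub (continuousOn_const.mul hu))

theorem memLp_secondRHS {k : Fin (n + 1)} (hu : MemLp u 2 (P.pieceMeasure k)) :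
    MemLp (P.secondRHS k lam u) 2 (P.pieceMeasure k) :=
  ((memLp_q_mul hu).sub (hu.const_mul lam)).const_mul _

/-- On the piece, `u'` is a primitive of a function that may be changed on a null set into the
continuous `secondRHS`; hence it is differentiable at every point, although the equation is assumed
only almost everywhere. -/
theorem Represents.hasDerivAt_deriv (hu : P.Represents u F) {k : Fin (n + 1)}
    (h : P.ell k u =ᵐ[P.pieceMeasure k] fun x => lam * u x) {x : ℝ} (hx : x ∈ P.piece k) :
    HasDerivAt (deriv u) (P.secondRHS k lam u x) x := by
  obtain ⟨α, β, hp⟩ := hu.regular k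
  have he : (P.piece k).indicator (deriv (deriv u)) =ᵐ[volume]
      (P.piece k).indicator (P.secondRHS k lam u) := by
    have h' := (ae_restrict_iff' measurableSet_Ioo).1 h
    filter_upwards [h'] with y hy
    by_cases hy' : y ∈ P.piece k
    · rw [indicator_of_mem hy', indicator_of_mem hy', ell_eq_iff.1 (hy hy')]
    · rw [indicator_of_notMem hy', indicator_of_notMem hy']
  have hloc : LocallyIntegrable ((P.piece k).indicator (P.secondRHS k lam u)) volume :=
    hp.locInt.congr he
  have hprim : prim (P.ξ k.castSucc) β ((P.piece k).indicator (deriv (deriv u))) =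
      prim (P.ξ k.castSucc) β ((P.piece k).indicator (P.secondRHS k lam u)) := by
    funext y
    rw [prim, prim, intervalIntegral.integral_congr_ae (he.mono fun z hz _ => hz)]
  have hn : P.piece k ∈ 𝓝 x := (isOpen_piece k).mem_nhds hx
  have heq : (P.piece k).indicator (P.secondRHS k lam u) =ᶠ[𝓝 x] P.secondRHS k lam u := by
    filter_upwards [hn] with y hy using indicator_of_mem hy _
  have hc : ContinuousAt ((P.piece k).indicator (P.secondRHS k lam u)) x :=
    ((continuousOn_secondRHS (hu.diff k).continuousOn).continuousAt hn).congr heq.symm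
  have hd : HasDerivAt (prim (P.ξ k.castSucc) β ((P.piece k).indicator (P.secondRHS k lam u)))
      ((P.piece k).indicator (P.secondRHS k lam u) x) x :=
    (intervalIntegral.integral_hasDerivAt_right (hloc.intervalIntegrable' _ _)
      hloc.aestronglyMeasurable.stronglyMeasurableAtFilter hc).const_add β
  rw [indicator_of_mem hx, ← hprim] at hd
  refine hd.congr_of_eventuallyEq ?_
  filter_upwards [hn] with y hy using hp.deriv_eqOn hy

/-- The scalar components are boundary values of `u`, so an eigenvector cannot live in `ℂ²` alone.
-/
theorem Represents.eq_zero (hu : P.Represents u F) (h : ∀ k, ∀ x ∈ P.piece k, u x = 0) :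
    F = 0 := by
  have h0 := represents_zero P
  have hc : P.IsComb 0 (fun _ => 0) (fun _ => 0) u := fun k x hx => by simp [h k x hx]
  obtain ⟨⟨-, hA, -, hB⟩, -⟩ := hc.functionals h0 h0
  refine H_ext (fun k => Lp.ext ?_) ?_ ?_
  · filter_upwards [hu.fn_eq k, h0.fn_eq k, ae_restrict_mem measurableSet_Ioo] with x h1 h2 h3
    rw [h1, h2, h k x h3]
  · rw [hu.cA_eq, h0.cA_eq, hA, zero_mul, add_zero]
  · rw [hu.cB_eq, h0.cB_eq, hB, zero_mul, add_zero]

theorem Represents.isSolution (hu : P.Represents u F) (h : hu.image = lam • F) :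
    P.IsSolution lam u := by
  have hell (k : Fin (n + 1)) : P.ell k u =ᵐ[P.pieceMeasure k] fun x => lam * u x := by
    have h1 : fn hu.image k = lam • fn F k := by rw [h]; rfl
    filter_upwards [hu.fn_image k, Lp.coeFn_smul lam (fn F k), hu.fn_eq k] with x e1 e2 e3
    rw [← e1, h1, e2, Pi.smul_apply, e3, smul_eq_mul]
  refine ⟨hu.diff, fun k x hx => ?_, hu.lim, hu.lim', fun k x hx => ?_, ?_, ?_, hu.trans₁,
    hu.trans₂⟩
  · exact (hu.hasDerivAt_deriv (hell k) hx).differentiableAt.differentiableWithinAt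
  · exact ell_eq_iff.2 (hu.hasDerivAt_deriv (hell k) hx).deriv
  · have h1 : P.Ba u = lam * cA F := congrArg cA h
    rw [h1, hu.cA_eq, sub_self]
  · have h1 : P.Bb u = lam * cB F := congrArg cB h
    rw [h1, hu.cB_eq]
    ring

/-- The equation expresses `u''` by the continuous functions `q` and `u`, so `u'` is continuously
differentiable and hence absolutely continuous on compact subintervals; boundedness of `q` and `u`
puts `u''` in `L²`. -/
theorem IsSolution.exists_regular (hu : P.IsSolution lam u) : ∃ φ, P.Regular u φ := by
  refine ⟨fun k => (P.piece k).indicator (deriv (deriv u)), fun k => ⟨_, _,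
    IsTwicePrim.of_locallyAC (hu.diff k) ?_ (hu.lim k) (hu.lim' k) ?_⟩⟩
  · have hc : ContDiffOn ℝ 1 (deriv u) (P.piece k) := by
      rw [← zero_add (1 : WithTop ℕ∞), contDiffOn_succ_iff_deriv_of_isOpen (isOpen_piece k)]
      refine ⟨hu.diff' k, by simp, contDiffOn_zero.2 ?_⟩
      exact (continuousOn_secondRHS (lam := lam) (hu.diff k).continuousOn).congr
        fun x hx => ell_eq_iff.1 (hu.eqn k x hx)
    intro x y hx hxy hy
    refine (hc.mono ?_).absolutelyContinuousOnInterval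
    rw [uIcc_of_le hxy]
    exact fun z hz => ⟨hx.trans_le hz.1, hz.2.trans_lt hy⟩
  · have hm : MemLp u 2 (P.pieceMeasure k) :=
      (memLp_top_of_continuousOn (hu.diff k).continuousOn (hu.lim k)).mono_exponent le_top
    refine (memLp_secondRHS (lam := lam) hm).ae_eq ?_
    filter_upwards [ae_restrict_mem measurableSet_Ioo] with x hx
    exact (ell_eq_iff.1 (hu.eqn k x hx)).symm

theorem IsSolution.exists_represents (hu : P.IsSolution lam u) :
    ∃ F, ∃ h : P.Represents u F, h.image = lam • F := by
  obtain ⟨φ, hr⟩ := hu.exists_regular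
  obtain ⟨F, hF⟩ := hr.exists_represents hu.trans₁ hu.trans₂
  refine ⟨F, hF, H_ext (fun k => Lp.ext ?_) ?_ ?_⟩
  · change _ =ᵐ[P.pieceMeasure k] (lam • fn F k : Lp ℂ 2 (P.pieceMeasure k))
    filter_upwards [hF.fn_image k, Lp.coeFn_smul lam (fn F k), hF.fn_eq k,
      ae_restrict_mem measurableSet_Ioo] with x e1 e2 e3 hx
    rw [e1, e2, Pi.smul_apply, e3, smul_eq_mul, hu.eqn k x hx]
  · change P.Ba u = lam * cA F
    rw [hF.cA_eq]
    exact sub_eq_zero.1 hu.left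
  · change P.Bb u = lam * cB F
    rw [hF.cB_eq]
    linear_combination hu.right

theorem hasEigenvalue_R_iff :
    (∃ F : P.R.domain, (F : P.H) ≠ 0 ∧ P.R F = lam • (F : P.H)) ↔ P.IsEigenvalue lam := by
  constructor
  · rintro ⟨F, hF, h⟩
    obtain ⟨u, hu⟩ := F.2
    rw [R_apply F hu] at h
    refine ⟨u, hu.isSolution h, ?_⟩
    by_contra! h0
    exact hF (hu.eq_zero h0)
  · rintro ⟨u, hu, k, x, hx, hne⟩
    obtain ⟨F, hF, h⟩ := hu.exists_represents
    refine ⟨⟨F, ⟨u, hF⟩⟩, fun h0 : F = 0 => hne ?_, by rw [R_apply _ hF, h]⟩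
    subst h0
    exact hF.eqOn (represents_zero P) k hx

end Eigenvalues

end

end TransmissionProblem

/-- Density needs no separate clause: a self-adjoint `LinearPMap` has dense domain. -/
theorem mainTheorem2 {n : ℕ} (P : TransmissionProblem n) :
    IsSelfAdjoint P.R ∧
      ∀ lam : ℂ, (∃ F : P.R.domain, (F : P.H) ≠ 0 ∧ P.R F = lam • (F : P.H)) ↔
        P.IsEigenvalue lam :=
  ⟨TransmissionProblem.isSelfAdjoint_R, fun _ => TransmissionProblem.hasEigenvalue_R_iff⟩
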